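/- All densities are probability densities on $\mathbb{R}$ with respect to Lebesgue measure. Write $p\prec q$ (monotone likelihood ratio order) if $q(x)/p(x)$ is nondecreasing in $x$, that is, $q(x)p(y)\le q(y)p(x)$ whenever $x\le y$. Let $g\prec f_0\prec f_1\prec f_2\prec\cdots$ be densities. For $\nu\in\{1,2,\dots\}\cup\{\infty\}$ let $\mathsf P_\nu$ (with expectation $\mathsf E_\nu$) be the law under which $X_1,X_2,\dots$ are independent, $X_n$ has density $g$ for $n<\nu$, and $X_n$ has density $f_{n-\nu}$ for $n\ge\nu$. Thus the data are i.i.d. with density $g$ before the change point $\nu$ and form an exploding process from time $\nu$ on. Log-likelihood ratios take values in $[-\infty,\infty]$. Stopping times are taken with respect to the filtration $\sigma(X_1,\dots,X_n)$, $n\ge 0$, and may be infinite. For a stopping time $\tau$ put $$ \mathcal L(\tau)=\sup_{\nu\ge1}\operatorname{ess\,sup}\ \mathsf E_\nu\big[(\tau-\nu+1)^+\,\big|\,X_1,\dots,X_{\nu-1}\big],\qquad \mathcal P(\tau)=\sup_{\nu\ge1}\ \mathsf E_\nu[\tau-\nu\mid\tau\ge\nu] $$ (Lorden's and Pollak's delays;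 in $\mathcal P$, those $\nu$ with $\mathsf P_\nu(\tau\ge\nu)=0$ are disregarded). For a threshold $A\in\mathbb{R}$ the EX-CUSUM stopping time is $$ \tau_{ec}(A)=\inf\{n\ge1: W_n>A\},\qquad W_n=\max_{1\le k\le n}\ \sum_{i=k}^n\log\frac{f_{i-k}(X_i)}{g(X_i)} . $$ **Theorem.** Let $D(f_{k-1}\|g)$ denote the Kullback--Leibler divergence. Assume that there are constants $C<\infty$ and $0<I<\infty$ such that for every $k\ge1$, with $X_k\sim f_{k-1}$, $$ \mathsf E\Big[\Big(\log\tfrac{f_{k-1}(X_k)}{g(X_k)}\Big)^4\Big]<\infty,\qquad \mathsf E\Big[\Big(\log\tfrac{f_{k-1}(X_k)}{g(X_k)}-D(f_{k-1}\|g)\Big)^4\Big]\le C, $$ and that $$ \frac1n\sum_{k=1}^nD(f_{k-1}\|g)\longrightarrow I\qquad(n\to\infty). $$ Then EX-CUSUM with threshold $A=\log\gamma$ is asymptotically optimal for both Lorden's and Pollak's minimax formulations. That is, for every $\gamma>0$ the stopping time $\tau_{ec}(\log\gamma)$ satisfies the false alarm constraint $\mathsf E_\infty[\tau_{ec}(\log\gamma)]\ge\gamma$,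 and, as $\gamma\to\infty$, $$ \frac{\mathcal L(\tau_{ec}(\log\gamma))}{\inf_{\tau:\,\mathsf E_\infty[\tau]\ge\gamma}\mathcal L(\tau)}\to1,\qquad \frac{\mathcal P(\tau_{ec}(\log\gamma))}{\inf_{\tau:\,\mathsf E_\infty[\tau]\ge\gamma}\mathcal P(\tau)}\to1, $$ where the infima are over stopping times. Moreover, both $\mathcal L(\tau_{ec}(\log\gamma))$ and $\mathcal P(\tau_{ec}(\log\gamma))$ equal $\frac{\log\gamma}{I}(1+o(1))$ as $\gamma\to\infty$. -/

import Mathlib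

open MeasureTheory ProbabilityTheory Filter Topology
open scoped ENNReal NNReal

namespace QCD

/-- A probability density on the real line (with respect to Lebesgue measure). It is allowed to
vanish on part of the line. -/
structure ProbDensity where
  toFun : ℝ → ℝ≥0
  measurable_toFun : Measurable toFun
  lintegral_eq_one : ∫⁻ x, (toFun x : ℝ≥0∞) = 1

instance : CoeFun ProbDensity fun _ => ℝ → ℝ≥0 := ⟨ProbDensity.toFun⟩

/-- The probability law on `ℝ` with density `p`. -/
noncomputable def ProbDensity.law (p : ProbDensity) : Measure ℝ :=
  volume.withDensity fun x => (p x : ℝ≥0∞)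

instance (p : ProbDensity) : IsProbabilityMeasure p.law :=
  ⟨by rw [ProbDensity.law, withDensity_apply _ MeasurableSet.univ, Measure.restrict_univ,
    p.lintegral_eq_one]⟩

/-- The monotone likelihood ratio order `p ≺ q`: the ratio `q x / p x` is (weakly) increasing
in `x`. It is written in cross-multiplied form, so that zeros of the densities are harmless. -/
def MLR (p q : ProbDensity) : Prop :=
  ∀ x y : ℝ, x ≤ y → q x * p y ≤ q y * p x

/-- The log-likelihood ratio `log (p x / q x)`, with values in the extended reals. It is `-∞` where
`p x = 0`, and `+∞` where `q x = 0 < p x`. -/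
noncomputable def logLR (p q : ProbDensity) (x : ℝ) : EReal :=
  ENNReal.log ((p x : ℝ≥0∞) / (q x : ℝ≥0∞))

/-- The Kullback-Leibler divergence `D(p ‖ q)`. -/
noncomputable def divergence (p q : ProbDensity) : ℝ≥0∞ :=
  InformationTheory.klDiv p.law q.law

/-- The space of observation sequences `(X₁, X₂, …)`; coordinate `i` of a sequence holds `X_{i+1}`. -/
abbrev Obs : Type := ℕ → ℝ

/-- The observation `X_n`, for `n ≥ 1`. -/
def X (n : ℕ) (ω : Obs) : ℝ := ω (n - 1)

lemma measurable_X (n : ℕ) : Measurable (X n) := measurable_pi_apply _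

/-- The density of `X_n` when the change point is `ν` (possibly `∞`): it is `g` if `n < ν`, and
`f_{n-ν}` if `n ≥ ν`. -/
noncomputable def obsDensity (g : ProbDensity) (f : ℕ → ProbDensity) (ν : ℕ∞) (n : ℕ) :
    ProbDensity :=
  open Classical in if (n : ℕ∞) < ν then g else f (n - ν.toNat)

/-- The law `P_ν` of the observation sequence with change point `ν ∈ {1, 2, …, ∞}`: the observations
are independent, and `X_n` has density `obsDensity g f ν n` for every `n ≥ 1`. -/
noncomputable def P (g : ProbDensity) (f : ℕ → ProbDensity) (ν : ℕ∞) : Measure Obs :=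
  Measure.infinitePi fun i : ℕ => (obsDensity g f ν (i + 1)).law

/-- The observation filtration: at time `n` it is the σ-algebra generated by `X₁, …, X_n`
(trivial at time `0`). -/
def obsFiltration : Filtration ℕ (inferInstance : MeasurableSpace Obs) where
  seq n := ⨆ i ∈ Finset.Icc 1 n, MeasurableSpace.comap (X i) inferInstance
  mono' _ _ h := biSup_mono fun _ hi => Finset.Icc_subset_Icc_right h hi
  le' _ := iSup₂_le fun i _ => (measurable_X i).comap_le

/-- The EX-CUSUM statistic `W_n = max_{1 ≤ k ≤ n} ∑_{i=k}^n log (f_{i-k}(X_i) / g(X_i))`,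
for `n ≥ 1`. -/
noncomputable def exCusumStat (g : ProbDensity) (f : ℕ → ProbDensity) (n : ℕ) (ω : Obs) : EReal :=
  (Finset.Icc 1 n).sup fun k => ∑ i ∈ Finset.Icc k n, logLR (f (i - k)) g (X i ω)

/-- The EX-CUSUM stopping time `inf {n ≥ 1 : W_n > A}` with threshold `A`. -/
noncomputable def exCusum (g : ProbDensity) (f : ℕ → ProbDensity) (A : ℝ) (ω : Obs) : ℕ∞ :=
  ⨅ (n : ℕ) (_ : 1 ≤ n ∧ (A : EReal) < exCusumStat g f n ω), (n : ℕ∞)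

/-- Lorden's delay `sup_{ν ≥ 1} ess sup E_ν[(τ - ν + 1)⁺ | X₁, …, X_{ν-1}]`. The subtraction in
`[0, ∞]` is truncated at zero, which gives the positive part. -/
noncomputable def lordenDelay (g : ProbDensity) (f : ℕ → ProbDensity) (τ : Obs → ℕ∞) : ℝ≥0∞ :=
  ⨆ (ν : ℕ) (_ : 1 ≤ ν),
    essSup (condLExp (obsFiltration (ν - 1)) (P g f ν)
      fun ω => (τ ω : ℝ≥0∞) + 1 - (ν : ℝ≥0∞)) (P g f ν)

/-- Pollak's delay `sup_{ν ≥ 1} E_ν[τ - ν | τ ≥ ν]`. Those `ν` for which the event `τ ≥ ν` has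
probability zero contribute `0`, that is, they are disregarded. -/
noncomputable def pollakDelay (g : ProbDensity) (f : ℕ → ProbDensity) (τ : Obs → ℕ∞) : ℝ≥0∞ :=
  ⨆ (ν : ℕ) (_ : 1 ≤ ν),
    ∫⁻ ω, ((τ ω : ℝ≥0∞) - (ν : ℝ≥0∞)) ∂(ProbabilityTheory.cond (P g f ν) {ω | (ν : ℕ∞) ≤ τ ω})

/-- The stopping times `τ` of the observation filtration that meet the false alarm constraint
`E_∞[τ] ≥ γ`. -/
def feasible (g : ProbDensity) (f : ℕ → ProbDensity) (γ : ℝ) : Set (Obs → ℕ∞) :=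
  {τ | IsStoppingTime obsFiltration τ ∧ ENNReal.ofReal γ ≤ ∫⁻ ω, (τ ω : ℝ≥0∞) ∂(P g f ⊤)}

/-- The smallest value of a delay criterion under the false alarm constraint `E_∞[τ] ≥ γ`. -/
noncomputable def optimalDelay (g : ProbDensity) (f : ℕ → ProbDensity)
    (delay : (Obs → ℕ∞) → ℝ≥0∞) (γ : ℝ) : ℝ≥0∞ :=
  ⨅ τ ∈ feasible g f γ, delay τ

/-- A family of stopping times, indexed by the false alarm constraint `γ`, is asymptotically optimal
for a delay criterion if each member meets its constraint and the ratio of its delay to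
the smallest delay possible tends to `1` as `γ → ∞`. -/
def IsAsymptoticallyOptimal (g : ProbDensity) (f : ℕ → ProbDensity)
    (delay : (Obs → ℕ∞) → ℝ≥0∞) (T : ℝ → Obs → ℕ∞) : Prop :=
  (∀ γ : ℝ, 0 < γ → T γ ∈ feasible g f γ) ∧
    Tendsto (fun γ : ℝ => delay (T γ) / optimalDelay g f delay γ) atTop (𝓝 1)

end QCD

/-!
Under `P_∞` all observations have density `g`, and on the first `n` observations `P_ν` has density
`pathLR g f ν n` with respect to `P_∞` (`P_apply_eq_setLIntegral_pathLR`). Everything rests on this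
change of measure, on the independence of past and future under `P_ν`, and on a fourth-moment tail
bound for the log-likelihood random walk after the change.

*False alarms* (`exCusum_mem_feasible`). At an alarm at time `n` the sum over `k ≤ n` of the
likelihood ratios `pathLR g f k n` is at least `γ`. Integrating over `{τ = n}` and changing measure
gives `γ P_∞(τ = n) ≤ ∑_{k ≤ n} P_k(τ = n)`. Summing over `n` bounds `γ P_∞(τ < ∞)` by
`∑_k P_k(τ ≥ k)`, which is `∑_k P_∞(τ ≥ k) = E_∞ τ` because `{τ ≥ k}` is decided before time `k`.

*Upper bound* (`eventually_lordenDelay_exCusum_le`). After the change EX-CUSUM stops no later than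
the first passage of the random walk `S_m = ∑_{j < m} log (f_j / g)(X_{ν+j})` above `log γ`, which
does not depend on the past. The mean of `S_m` is `drift g f m ~ I m`, and the fourth-moment bound
gives `P_ν(|S_m - E S_m| ≥ c m) = O(m⁻²)`. These tails are summable, so the mean passage time is at
most `log γ / J + O(1)` for every `J < I`.

*Lower bound* (`eventually_le_pollakDelay`). If `E_∞ τ ≥ γ`, then for some `ν` the conditional
`P_∞`-probability, given `τ ≥ ν`, that `τ` stops within the next `m` steps is at most `2 m / γ`
(`exists_window`). Changing measure on the event `S_m ≤ b` costs a factor `exp b`. With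
`m ≈ log γ / J₁` and `b = J₂ m`, where `I < J₂ < J₁`, both `exp b * 2 m / γ` and `P_ν(S_m > b)` tend
to `0`, so under `P_ν` the delay is at least `m` with probability close to `1`.

Pollak's delay is at most Lorden's for every stopping time (`pollakDelay_le_lordenDelay`), so the
two bounds pin down both criteria, and their optimal values, to first order.
-/

namespace QCD

/-! ### Likelihood ratios of densities -/

lemma measurable_ereal_abs : Measurable EReal.abs :=
  EReal.measurable_of_measurable_real
    (ENNReal.measurable_ofReal.comp continuous_abs.measurable)

lemma measurable_coe_density (p : ProbDensity) : Measurable fun x => (p x : ℝ≥0∞) :=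
  p.measurable_toFun.coe_nnreal_ennreal

/-- The likelihood ratio `p x / q x`, with values in `[0, ∞]`; it is `∞` where `q x = 0 < p x` and
`0` where `p x = 0`. -/
noncomputable def likelihoodRatio (p q : ProbDensity) (x : ℝ) : ℝ≥0∞ :=
  (p x : ℝ≥0∞) / (q x : ℝ≥0∞)

lemma measurable_likelihoodRatio (p q : ProbDensity) : Measurable (likelihoodRatio p q) :=
  (measurable_coe_density p).div (measurable_coe_density q)

lemma logLR_eq_log_likelihoodRatio (p q : ProbDensity) (x : ℝ) :
    logLR p q x = ENNReal.log (likelihoodRatio p q x) := rfl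

lemma measurable_logLR (p q : ProbDensity) : Measurable (logLR p q) :=
  (measurable_likelihoodRatio p q).ennreal_log

/-- The real-valued log-likelihood ratio; it takes the value `0` where `logLR` is infinite. -/
noncomputable def realLogLR (p q : ProbDensity) (x : ℝ) : ℝ := (logLR p q x).toReal

lemma measurable_realLogLR (p q : ProbDensity) : Measurable (realLogLR p q) :=
  (measurable_logLR p q).ereal_toReal

/-- A finite absolute moment rules out infinite values of the log-likelihood ratio. -/
lemma ae_coe_realLogLR_eq {p q : ProbDensity}
    (h : ∫⁻ x, (logLR p q x).abs ^ 4 ∂p.law < ∞) :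
    ∀ᵐ x ∂p.law, (realLogLR p q x : EReal) = logLR p q x := by
  have h1 := ae_lt_top ((measurable_ereal_abs.comp (measurable_logLR p q)).pow_const 4) h.ne
  filter_upwards [h1] with x hx
  refine EReal.coe_toReal ?_ ?_
  · intro h'; simp [h'] at hx
  · intro h'; simp [h'] at hx

lemma law_eq_withDensity_likelihoodRatio {p q : ProbDensity}
    (h : ∀ᵐ x ∂p.law, (realLogLR p q x : EReal) = logLR p q x) :
    p.law = q.law.withDensity (likelihoodRatio p q) := by
  rw [ProbDensity.law, ae_withDensity_iff (measurable_coe_density p)] at h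
  rw [ProbDensity.law, ProbDensity.law, ← withDensity_mul _ (measurable_coe_density q)
    (measurable_likelihoodRatio p q)]
  refine withDensity_congr_ae ?_
  filter_upwards [h] with x hx
  simp only [Pi.mul_apply, likelihoodRatio]
  by_cases hq : (q x : ℝ≥0∞) = 0
  · by_contra hne
    have hp : (p x : ℝ≥0∞) ≠ 0 := by
      intro hp; simp [hp] at hne
    have := hx hp
    rw [logLR, hq, ENNReal.div_zero hp] at this
    simp at this
  · rw [ENNReal.mul_div_cancel hq ENNReal.coe_ne_top]

section Moments

variable {p q : ProbDensity} (h : ∫⁻ x, (logLR p q x).abs ^ 4 ∂p.law < ∞)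
include h

lemma memLp_realLogLR : MemLp (realLogLR p q) 4 p.law := by
  refine ⟨(measurable_realLogLR p q).aestronglyMeasurable, ?_⟩
  rw [eLpNorm_lt_top_iff_lintegral_rpow_enorm_lt_top (by norm_num) (by norm_num)]
  refine lt_of_le_of_lt (le_of_eq (lintegral_congr_ae ?_)) h
  filter_upwards [ae_coe_realLogLR_eq h] with x hx
  rw [← hx, EReal.abs_def, Real.enorm_eq_ofReal_abs]
  norm_num

lemma law_absolutelyContinuous : p.law ≪ q.law := by
  rw [law_eq_withDensity_likelihoodRatio (ae_coe_realLogLR_eq h)]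
  exact withDensity_absolutelyContinuous _ _

lemma llr_ae_eq_realLogLR : llr p.law q.law =ᵐ[p.law] realLogLR p q := by
  have h1 : p.law.rnDeriv q.law =ᵐ[q.law] likelihoodRatio p q := by
    conv_lhs => rw [law_eq_withDensity_likelihoodRatio (ae_coe_realLogLR_eq h)]
    exact Measure.rnDeriv_withDensity _ (measurable_likelihoodRatio p q)
  filter_upwards [(law_absolutelyContinuous h).ae_eq h1, ae_coe_realLogLR_eq h] with x hx hx'
  rw [llr, hx, realLogLR, logLR_eq_log_likelihoodRatio]
  rw [logLR_eq_log_likelihoodRatio] at hx'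
  rw [ENNReal.log_pos_real]
  · rfl
  · intro h0; simp [h0] at hx'
  · intro h0; simp [h0] at hx'

lemma integrable_realLogLR : Integrable (realLogLR p q) p.law :=
  (memLp_realLogLR h).integrable (by norm_num)

lemma divergence_ne_top : divergence p q ≠ ∞ :=
  InformationTheory.klDiv_ne_top (law_absolutelyContinuous h)
    ((integrable_realLogLR h).congr (llr_ae_eq_realLogLR h).symm)

lemma integral_realLogLR : ∫ x, realLogLR p q x ∂p.law = (divergence p q).toReal := by
  rw [divergence, InformationTheory.toReal_klDiv_of_measure_eq (law_absolutelyContinuous h)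
    (by simp), integral_congr_ae (llr_ae_eq_realLogLR h)]

lemma integral_centered_pow_four_le {C : ℝ≥0}
    (hC : ∫⁻ x, (logLR p q x - (divergence p q : EReal)).abs ^ 4 ∂p.law ≤ C) :
    ∫ x, (realLogLR p q x - (divergence p q).toReal) ^ 4 ∂p.law ≤ C := by
  rw [integral_eq_lintegral_of_nonneg_ae (ae_of_all _ fun x => by positivity)
    (((measurable_realLogLR p q).sub_const _).pow_const 4).aestronglyMeasurable]
  refine ENNReal.toReal_le_of_le_ofReal C.2 ?_
  refine le_trans (le_of_eq (lintegral_congr_ae ?_)) (hC.trans (by simp))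
  filter_upwards [ae_coe_realLogLR_eq h] with x hx
  have hd : ((divergence p q : ℝ≥0∞) : EReal) = ((divergence p q).toReal : ℝ) :=
    (EReal.coe_ennreal_toReal (divergence_ne_top h)).symm
  rw [← hx, hd, ← EReal.coe_sub, EReal.abs_def, ← ENNReal.ofReal_pow (abs_nonneg _)]
  congr 1
  exact ((by decide : Even 4).pow_abs _).symm

end Moments

/-! ### Change of measure -/

/-- Tilting finitely many coordinates of a product measure by densities `ℓ i` gives the product
measure with those marginals tilted. -/
lemma infinitePi_eq_withDensity_prod {μ ρ : ℕ → Measure ℝ} [∀ i, IsProbabilityMeasure (μ i)]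
    [∀ i, IsProbabilityMeasure (ρ i)] (s : Finset ℕ) {l : ℕ → ℝ → ℝ≥0∞}
    (hl : ∀ i, Measurable (l i)) (hs : ∀ i ∈ s, ρ i = (μ i).withDensity (l i))
    (hs' : ∀ i ∉ s, ρ i = μ i) :
    Measure.infinitePi ρ =
      (Measure.infinitePi μ).withDensity fun ω => ∏ i ∈ s, l i (ω i) := by
  classical
  symm
  refine Measure.eq_infinitePi _ fun t B hB => ?_
  have hBm : MeasurableSet (Set.pi (t : Set ℕ) B) :=
    MeasurableSet.pi t.countable_toSet fun i _ => hB i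
  rw [withDensity_apply _ hBm, ← lintegral_indicator hBm]
  -- On a box the density splits into a product of one function per coordinate.
  let k : ℕ → ℝ → ℝ≥0∞ := fun i x =>
    (if i ∈ t then (B i).indicator 1 x else 1) * (if i ∈ s then l i x else 1)
  have hk : ∀ i, Measurable (k i) := by
    intro i
    refine Measurable.mul ?_ ?_
    · by_cases h : i ∈ t
      · simpa [h] using (measurable_one.indicator (hB i))
      · simp [h]
    · by_cases h : i ∈ s
      · simpa [h] using hl i
      · simp [h]
  have hfun : (Set.pi (t : Set ℕ) B).indicator (fun ω : ℕ → ℝ => ∏ i ∈ s, l i (ω i))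
      = fun ω => ∏ i ∈ s ∪ t, k i (ω i) := by
    funext ω
    rw [Finset.prod_mul_distrib, Finset.prod_ite_mem, Finset.prod_ite_mem,
      Finset.union_inter_cancel_right, Finset.union_inter_cancel_left]
    by_cases hω : ω ∈ Set.pi (t : Set ℕ) B
    · have h1 : ∏ i ∈ t, (B i).indicator (1 : ℝ → ℝ≥0∞) (ω i) = 1 :=
        Finset.prod_eq_one fun i hi => by simp [Set.indicator_of_mem (hω i hi)]
      rw [Set.indicator_of_mem hω, h1, one_mul]
    · rw [Set.indicator_of_notMem hω]
      simp only [Set.mem_pi, not_forall] at hω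
      obtain ⟨i, hi, hiB⟩ := hω
      rw [Finset.prod_eq_zero (Finset.mem_coe.1 hi) (Set.indicator_of_notMem hiB _), zero_mul]
  rw [hfun]
  refine (lintegral_prod_eq_prod_lintegral_of_indepFun (s ∪ t) (fun i (ω : ℕ → ℝ) => k i (ω i))
    (iIndepFun_infinitePi hk) (fun i => (hk i).comp (measurable_pi_apply i))).trans ?_
  have hint : ∀ i, ∫⁻ ω, k i (ω i) ∂(Measure.infinitePi μ) =
      if i ∈ t then ρ i (B i) else 1 := by
    intro i
    have hmp := (measurePreserving_eval_infinitePi μ i).lintegral_comp (hk i)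
    simp only [Function.eval] at hmp
    rw [hmp]
    have h1 : ∫⁻ x, k i x ∂(μ i) =
        ∫⁻ x, (if i ∈ t then (B i).indicator 1 x else 1) ∂(ρ i) := by
      by_cases h : i ∈ s
      · rw [hs i h, lintegral_withDensity_eq_lintegral_mul _ (hl i)]
        · refine lintegral_congr fun x => ?_
          simp only [k, h, if_true, Pi.mul_apply]
          rw [mul_comm]
        · by_cases h : i ∈ t
          · simpa [h] using (measurable_one.indicator (hB i))
          · simp [h]
      · rw [hs' i h]
        simp [k, h]
    rw [h1]
    by_cases h : i ∈ t
    · simp only [h, if_true]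
      rw [lintegral_indicator_one (hB i)]
    · simp [h]
  simp_rw [hint]
  rw [Finset.prod_ite_mem, Finset.union_inter_cancel_right]

/-- The law of a product measure on events of the first `n` observations depends on the first `n`
marginals only. -/
lemma infinitePi_apply_eq_of_measurableSet_obsFiltration {μ ρ : ℕ → Measure ℝ}
    [∀ i, IsProbabilityMeasure (μ i)] [∀ i, IsProbabilityMeasure (ρ i)] {n : ℕ}
    (h : ∀ i < n, μ i = ρ i) {B : Set Obs} (hB : MeasurableSet[obsFiltration n] B) :
    Measure.infinitePi μ B = Measure.infinitePi ρ B := by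
  have hle : obsFiltration n ≤
      MeasurableSpace.comap (Finset.restrict (π := fun _ : ℕ => ℝ) (Finset.range n))
        MeasurableSpace.pi := by
    refine iSup₂_le fun i hi => ?_
    rw [Finset.mem_Icc] at hi
    have : X i = (fun y : (∀ _ : Finset.range n, ℝ) =>
        y ⟨i - 1, Finset.mem_range.2 (by omega)⟩) ∘
        (Finset.restrict (π := fun _ : ℕ => ℝ) (Finset.range n)) := rfl
    rw [this, ← MeasurableSpace.comap_comp]
    exact MeasurableSpace.comap_mono (measurable_pi_apply _).comap_le
  obtain ⟨S, hS, rfl⟩ := hle B hB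
  rw [← Measure.map_apply (by fun_prop) hS, ← Measure.map_apply (by fun_prop) hS,
    Measure.infinitePi_map_restrict, Measure.infinitePi_map_restrict]
  congr 2
  funext i
  exact h i (Finset.mem_range.1 i.2)

instance isProbabilityMeasure_P (g : ProbDensity) (f : ℕ → ProbDensity) (ν : ℕ∞) :
    IsProbabilityMeasure (P g f ν) := by
  unfold P; infer_instance

lemma obsDensity_of_lt (g : ProbDensity) (f : ℕ → ProbDensity) {ν n : ℕ} (h : n < ν) :
    obsDensity g f ν n = g := by
  simp [obsDensity, h]

lemma obsDensity_of_le (g : ProbDensity) (f : ℕ → ProbDensity) {ν n : ℕ} (h : ν ≤ n) :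
    obsDensity g f ν n = f (n - ν) := by
  simp [obsDensity, not_lt.2 h]

lemma obsDensity_top (g : ProbDensity) (f : ℕ → ProbDensity) (n : ℕ) :
    obsDensity g f ⊤ n = g := by
  simp [obsDensity]

/-- The likelihood ratio of `P_ν` to `P_∞` on the first `n` observations, equal to `1` for
`n < ν`. -/
noncomputable def pathLR (g : ProbDensity) (f : ℕ → ProbDensity) (ν n : ℕ) (ω : Obs) : ℝ≥0∞ :=
  ∏ i ∈ Finset.Icc ν n, likelihoodRatio (f (i - ν)) g (X i ω)

lemma measurable_pathLR (g : ProbDensity) (f : ℕ → ProbDensity) (ν n : ℕ) :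
    Measurable (pathLR g f ν n) :=
  Finset.measurable_prod _ fun i _ => (measurable_likelihoodRatio _ _).comp (measurable_X i)

variable {g : ProbDensity} {f : ℕ → ProbDensity}

lemma P_apply_eq_setLIntegral_pathLR
    (hac : ∀ n, (f n).law = g.law.withDensity (likelihoodRatio (f n) g))
    {ν n : ℕ} (hν : 1 ≤ ν) {B : Set Obs} (hB : MeasurableSet[obsFiltration n] B) :
    P g f ν B = ∫⁻ ω in B, pathLR g f ν n ω ∂(P g f ⊤) := by
  -- The product measure whose marginals agree with `P_ν` up to time `n` and with `P_∞` afterwards.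
  let ρ : ℕ → Measure ℝ := fun i => if i < n then (obsDensity g f ν (i + 1)).law else g.law
  have : ∀ i, IsProbabilityMeasure (ρ i) := by
    intro i
    simp only [ρ]
    split_ifs <;> infer_instance
  have h1 : P g f ν B = Measure.infinitePi ρ B :=
    infinitePi_apply_eq_of_measurableSet_obsFiltration (fun i hi => by simp [ρ, hi]) hB
  have htop : P g f ⊤ = Measure.infinitePi fun _ : ℕ => g.law := by
    simp only [P, obsDensity_top]
  have h2 : Measure.infinitePi ρ = (Measure.infinitePi fun _ : ℕ => g.law).withDensity
      fun ω => ∏ i ∈ Finset.Ico (ν - 1) n, likelihoodRatio (f (i + 1 - ν)) g (ω i) := by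
    refine infinitePi_eq_withDensity_prod (Finset.Ico (ν - 1) n)
      (l := fun i => likelihoodRatio (f (i + 1 - ν)) g)
      (fun i => measurable_likelihoodRatio _ _) ?_ ?_
    · intro i hi
      rw [Finset.mem_Ico] at hi
      simp only [ρ, hi.2, if_true]
      rw [obsDensity_of_le g f (by omega : ν ≤ i + 1), ← hac]
    · intro i hi
      rw [Finset.mem_Ico] at hi
      simp only [ρ]
      split_ifs with hin
      · rw [obsDensity_of_lt g f (by omega : i + 1 < ν)]
      · rfl
  rw [h1, h2, withDensity_apply _ (obsFiltration.le n _ hB), htop]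
  refine lintegral_congr fun ω => ?_
  refine Finset.prod_bij (fun i _ => i + 1) ?_ ?_ ?_ ?_
  · intro i hi; simp only [Finset.mem_Ico, Finset.mem_Icc] at *; omega
  · intro i _ j _ hij; omega
  · intro i hi
    rw [Finset.mem_Icc] at hi
    exact ⟨i - 1, by rw [Finset.mem_Ico]; omega, by omega⟩
  · intro i _; rfl

/-- Before the change point `P_ν` and `P_∞` agree. -/
lemma P_apply_eq_P_top_apply {ν n : ℕ} (hn : n < ν) {B : Set Obs}
    (hB : MeasurableSet[obsFiltration n] B) : P g f ν B = P g f ⊤ B := by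
  refine infinitePi_apply_eq_of_measurableSet_obsFiltration (fun i hi => ?_) hB
  rw [obsDensity_of_lt g f (by omega : i + 1 < ν), obsDensity_top]

/-! ### The false alarm constraint -/

lemma natCast_le_coe_enat {r : ℕ} {k : ℕ∞} (h : (r : ℕ∞) ≤ k) : (r : ℝ≥0∞) ≤ (k : ℝ≥0∞) := by
  rw [← ENat.toENNReal_coe]
  exact ENat.toENNReal_le.2 h

/-- A number in `ℕ∞` is the number of positive integers below it. -/
lemma coe_enat_eq_tsum (k : ℕ∞) :
    (k : ℝ≥0∞) = ∑' n : ℕ, if ((n + 1 : ℕ) : ℕ∞) ≤ k then 1 else 0 := by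
  induction k using ENat.recTopCoe with
  | top => simp
  | coe k =>
    rw [tsum_eq_sum (s := Finset.range k)]
    · rw [Finset.sum_congr rfl (g := fun _ => (1 : ℝ≥0∞))]
      · simp
      · intro n hn
        rw [Finset.mem_range] at hn
        rw [if_pos (by exact_mod_cast hn)]
    · intro n hn
      rw [Finset.mem_range] at hn
      rw [if_neg]
      intro h
      have : n + 1 ≤ k := by exact_mod_cast h
      omega

section StoppingTimes

variable {τ : Obs → ℕ∞} (hτ : IsStoppingTime obsFiltration τ)
include hτ

lemma measurableSet_natCast_le {ν n : ℕ} (h : ν ≤ n + 1) :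
    MeasurableSet[obsFiltration n] {ω | (ν : ℕ∞) ≤ τ ω} := by
  rcases Nat.eq_zero_or_pos ν with rfl | hν
  · simp
  have h1 : {ω | (ν : ℕ∞) ≤ τ ω} = {ω | τ ω ≤ ((ν - 1 : ℕ) : ℕ∞)}ᶜ := by
    ext ω
    simp only [Set.mem_ofPred_eq, Set.mem_compl_iff, not_le]
    obtain ⟨m, rfl⟩ : ∃ m, ν = m + 1 := ⟨ν - 1, by omega⟩
    simpa using ENat.add_one_le_iff (ENat.natCast_ne_top m)
  rw [h1]
  exact (obsFiltration.mono (by omega : ν - 1 ≤ n) _ (hτ (ν - 1))).compl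

lemma measurableSet_eq_natCast (n : ℕ) :
    MeasurableSet[obsFiltration n] {ω | τ ω = (n : ℕ∞)} :=
  hτ.measurableSet_eq n

lemma measurable_coe_stoppingTime : Measurable fun ω => (τ ω : ℝ≥0∞) := by
  simp_rw [coe_enat_eq_tsum]
  refine Measurable.tsum fun n => ?_
  exact Measurable.ite (obsFiltration.le _ _ (measurableSet_natCast_le hτ (n := n) le_rfl))
    measurable_const measurable_const

lemma lintegral_stoppingTime_eq_tsum (μ : Measure Obs) :
    ∫⁻ ω, (τ ω : ℝ≥0∞) ∂μ = ∑' n : ℕ, μ {ω | ((n + 1 : ℕ) : ℕ∞) ≤ τ ω} := by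
  have hm : ∀ n : ℕ, MeasurableSet {ω | ((n + 1 : ℕ) : ℕ∞) ≤ τ ω} := fun n =>
    obsFiltration.le _ _ (measurableSet_natCast_le hτ (n := n) le_rfl)
  simp_rw [coe_enat_eq_tsum (τ _)]
  rw [lintegral_tsum fun n => (Measurable.ite (hm n) measurable_const
    measurable_const).aemeasurable]
  refine tsum_congr fun n => ?_
  rw [← lintegral_indicator_one (hm n)]
  refine lintegral_congr fun ω => ?_
  by_cases h : ((n + 1 : ℕ) : ℕ∞) ≤ τ ω
  · rw [if_pos h, Set.indicator_of_mem (show ω ∈ {ω | ((n + 1 : ℕ) : ℕ∞) ≤ τ ω} from h)]; rfl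
  · rw [if_neg h, Set.indicator_of_notMem (show ω ∉ {ω | ((n + 1 : ℕ) : ℕ∞) ≤ τ ω} from h)]

end StoppingTimes

lemma exCusum_le_iff {A : ℝ} {ω : Obs} {n : ℕ} :
    exCusum g f A ω ≤ n ↔ ∃ m, 1 ≤ m ∧ m ≤ n ∧ (A : EReal) < exCusumStat g f m ω := by
  constructor
  · intro h
    by_contra! hc
    have : ((n + 1 : ℕ) : ℕ∞) ≤ exCusum g f A ω := by
      refine le_iInf₂ fun m hm => ?_
      by_contra! hlt
      have hlt' : m < n + 1 := by exact_mod_cast hlt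
      exact absurd hm.2 (not_lt.2 (hc m hm.1 (by omega)))
    have h2 := this.trans h
    have h3 : n + 1 ≤ n := by exact_mod_cast h2
    omega
  · rintro ⟨m, h1, h2, h3⟩
    exact (iInf₂_le m ⟨h1, h3⟩).trans (by exact_mod_cast h2)

lemma lt_exCusumStat_of_exCusum_eq {A : ℝ} {ω : Obs} {n : ℕ} (h : exCusum g f A ω = n) :
    1 ≤ n ∧ (A : EReal) < exCusumStat g f n ω := by
  obtain ⟨m, h1, h2, h3⟩ := exCusum_le_iff.1 h.le
  have h4 : exCusum g f A ω ≤ m := exCusum_le_iff.2 ⟨m, h1, le_rfl, h3⟩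
  rw [h] at h4
  have : n ≤ m := by exact_mod_cast h4
  obtain rfl : m = n := by omega
  exact ⟨h1, h3⟩

lemma isStoppingTime_exCusum (A : ℝ) : IsStoppingTime obsFiltration (exCusum g f A) := by
  intro n
  have h1 : {ω | exCusum g f A ω ≤ n} =
      ⋃ m ∈ Finset.Icc 1 n, {ω | (A : EReal) < exCusumStat g f m ω} := by
    ext ω
    simp [exCusum_le_iff, and_assoc]
  have h2 : MeasurableSet[obsFiltration n] {ω | exCusum g f A ω ≤ n} := by
    rw [h1]
    refine Finset.measurableSet_biUnion _ fun m hm => ?_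
    rw [Finset.mem_Icc] at hm
    have hX : ∀ i ∈ Finset.Icc 1 n, Measurable[obsFiltration n] (X i) := fun i hi =>
      measurable_iff_comap_le.2 (le_iSup₂ (f := fun i (_ : i ∈ Finset.Icc 1 n) =>
        MeasurableSpace.comap (X i) inferInstance) i hi)
    have hsup : {ω | (A : EReal) < exCusumStat g f m ω} = ⋃ k ∈ Finset.Icc 1 m,
        {ω | (A : EReal) < ∑ i ∈ Finset.Icc k m, logLR (f (i - k)) g (X i ω)} := by
      ext ω
      simp [exCusumStat, Finset.lt_sup_iff]
    rw [hsup]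
    refine Finset.measurableSet_biUnion _ fun k hk => ?_
    refine measurableSet_lt measurable_const ?_
    refine Finset.measurable_sum _ fun i hi => (measurable_logLR _ _).comp (hX i ?_)
    rw [Finset.mem_Icc] at *
    omega
  exact h2

lemma log_prod_eq_sum_log (s : Finset ℕ) (a : ℕ → ℝ≥0∞) :
    ENNReal.log (∏ i ∈ s, a i) = ∑ i ∈ s, ENNReal.log (a i) := by
  classical
  induction s using Finset.induction_on with
  | empty => simp
  | insert i s hi ih => rw [Finset.prod_insert hi, Finset.sum_insert hi, ENNReal.log_mul_add, ih]

lemma lt_exCusumStat_iff {γ : ℝ} (hγ : 0 < γ) {n : ℕ} {ω : Obs} :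
    ((Real.log γ : ℝ) : EReal) < exCusumStat g f n ω ↔
      ∃ k ∈ Finset.Icc 1 n, ENNReal.ofReal γ < pathLR g f k n ω := by
  rw [exCusumStat, Finset.lt_sup_iff]
  refine exists_congr fun k => and_congr_right fun _ => ?_
  rw [← ENNReal.log_ofReal_of_pos hγ, pathLR]
  simp_rw [logLR_eq_log_likelihoodRatio]
  rw [← log_prod_eq_sum_log, ENNReal.log_lt_log_iff]

/-- At an alarm the sum of the likelihood ratios over the candidate change points exceeds the
threshold; a change of measure turns its expectation under `P_∞` into probabilities under the
`P_k`, and before the change these are probabilities under `P_∞` again. -/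
lemma ofReal_mul_measure_lt_top_le_lintegral_exCusum
    (hac : ∀ n, (f n).law = g.law.withDensity (likelihoodRatio (f n) g)) {γ : ℝ} (hγ : 0 < γ) :
    ENNReal.ofReal γ * P g f ⊤ {ω | exCusum g f (Real.log γ) ω < ⊤} ≤
      ∫⁻ ω, (exCusum g f (Real.log γ) ω : ℝ≥0∞) ∂(P g f ⊤) := by
  set τ := exCusum g f (Real.log γ)
  have hτ : IsStoppingTime obsFiltration τ := isStoppingTime_exCusum _
  have hmeq : ∀ n : ℕ, MeasurableSet {ω | τ ω = (n : ℕ∞)} := fun n =>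
    obsFiltration.le _ _ (measurableSet_eq_natCast hτ n)
  have hunion : {ω | τ ω < ⊤} = ⋃ n : ℕ, {ω | τ ω = (n : ℕ∞)} := by
    ext ω
    simp only [Set.mem_ofPred_eq, Set.mem_iUnion]
    constructor
    · intro h
      exact ⟨(τ ω).toNat, (ENat.natCast_toNat h.ne).symm⟩
    · rintro ⟨n, hn⟩
      rw [hn]
      exact ENat.natCast_lt_top n
  have hdisj : Pairwise (Function.onFun Disjoint fun n : ℕ => {ω | τ ω = (n : ℕ∞)}) := by
    intro i j hij
    refine Set.disjoint_left.2 fun ω (hi : τ ω = i) (hj : τ ω = j) => hij ?_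
    rw [hi] at hj
    exact_mod_cast hj
  -- The contribution of alarms at time `n`.
  have hstep : ∀ n : ℕ, ENNReal.ofReal γ * P g f ⊤ {ω | τ ω = (n : ℕ∞)} ≤
      ∑' k : ℕ, P g f ((k + 1 : ℕ) : ℕ∞)
        ({ω | τ ω = (n : ℕ∞)} ∩ {ω | ((k + 1 : ℕ) : ℕ∞) ≤ τ ω}) := by
    intro n
    have h1 : ENNReal.ofReal γ * P g f ⊤ {ω | τ ω = (n : ℕ∞)} ≤
        ∫⁻ ω in {ω | τ ω = (n : ℕ∞)}, ∑ k ∈ Finset.range n, pathLR g f (k + 1) n ω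
          ∂(P g f ⊤) := by
      rw [← setLIntegral_const]
      refine setLIntegral_mono' (hmeq n) fun ω (hω : τ ω = n) => ?_
      obtain ⟨k, hk, hlt⟩ := (lt_exCusumStat_iff hγ).1 (lt_exCusumStat_of_exCusum_eq hω).2
      rw [Finset.mem_Icc] at hk
      refine hlt.le.trans ?_
      have := Finset.single_le_sum (f := fun k => pathLR g f (k + 1) n ω)
        (fun _ _ => zero_le) (Finset.mem_range.2 (by omega : k - 1 < n))
      simpa [Nat.sub_add_cancel hk.1] using this
    refine h1.trans ?_
    rw [lintegral_finsetSum _ fun k _ => measurable_pathLR g f _ _]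
    refine le_trans (Finset.sum_le_sum fun k hk => ?_) (ENNReal.sum_le_tsum (Finset.range n))
    rw [Finset.mem_range] at hk
    rw [← P_apply_eq_setLIntegral_pathLR hac (by omega) (measurableSet_eq_natCast hτ n)]
    refine measure_mono fun ω (hω : τ ω = n) => ⟨hω, ?_⟩
    change _ ≤ τ ω
    rw [hω]
    exact_mod_cast hk
  rw [hunion, measure_iUnion hdisj hmeq, ← ENNReal.tsum_mul_left]
  refine (ENNReal.tsum_le_tsum hstep).trans ?_
  rw [ENNReal.tsum_comm, lintegral_stoppingTime_eq_tsum hτ]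
  refine ENNReal.tsum_le_tsum fun k => ?_
  have hmk := measurableSet_natCast_le hτ (ν := k + 1) (n := k) le_rfl
  rw [← measure_iUnion (fun i j hij => (hdisj hij).mono Set.inter_subset_left
    Set.inter_subset_left) (fun n => (hmeq n).inter (obsFiltration.le _ _ hmk)),
    ← P_apply_eq_P_top_apply (Nat.lt_succ_self k) hmk]
  exact measure_mono (Set.iUnion_subset fun n => Set.inter_subset_right)

lemma exCusum_mem_feasible
    (hac : ∀ n, (f n).law = g.law.withDensity (likelihoodRatio (f n) g)) {γ : ℝ} (hγ : 0 < γ) :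
    exCusum g f (Real.log γ) ∈ feasible g f γ := by
  refine ⟨isStoppingTime_exCusum _, ?_⟩
  set τ := exCusum g f (Real.log γ)
  have hτ : IsStoppingTime obsFiltration τ := isStoppingTime_exCusum _
  by_cases htop : P g f ⊤ {ω | τ ω = ⊤} = 0
  · have h1 : P g f ⊤ {ω | τ ω < ⊤} = 1 := by
      rw [← prob_compl_eq_zero_iff]
      · simpa [Set.compl_def] using htop
      · have h2 : MeasurableSet ((fun ω => (τ ω : ℝ≥0∞)) ⁻¹' Set.Iio ⊤) :=
          measurable_coe_stoppingTime hτ measurableSet_Iio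
        simpa [Set.preimage] using h2
    have h2 := ofReal_mul_measure_lt_top_le_lintegral_exCusum hac hγ
    rwa [h1, mul_one] at h2
  · have : ∫⁻ ω, (τ ω : ℝ≥0∞) ∂(P g f ⊤) = ⊤ := by
      refine lintegral_eq_top_of_measure_eq_top_ne_zero
        (measurable_coe_stoppingTime hτ).aemeasurable ?_
      simpa using htop
    rw [this]
    exact le_top

/-! ### Fourth moments of sums of independent centred variables -/

lemma integrable_pow_of_memLp_four {Ω : Type*} {mΩ : MeasurableSpace Ω} {μ : Measure Ω}
    [IsFiniteMeasure μ] {Y : Ω → ℝ} (hY : MemLp Y 4 μ) {k : ℕ} (hk : k ≤ 4) :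
    Integrable (fun ω => Y ω ^ k) μ := by
  have h1 : MemLp Y k μ := hY.mono_exponent (by exact_mod_cast hk)
  refine (h1.integrable_norm_pow').mono (hY.1.pow k) (ae_of_all _ fun ω => ?_)
  simp

/-- For independent centred variables with fourth moments at most `C`, the fourth moment of a sum
of `m` of them is at most `3 (1 + C)² m²`: in the expansion only the terms `Z_i⁴` and `Z_i² Z_j²`
survive. -/
lemma integral_sum_pow_four_le {Ω : Type*} {mΩ : MeasurableSpace Ω} {μ : Measure Ω}
    [IsProbabilityMeasure μ] {Z : ℕ → Ω → ℝ} (hind : iIndepFun Z μ)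
    (hmeas : ∀ j, Measurable (Z j)) (hL : ∀ j, MemLp (Z j) 4 μ) (h0 : ∀ j, ∫ ω, Z j ω ∂μ = 0)
    {C : ℝ} (hC0 : 0 ≤ C) (hC : ∀ j, ∫ ω, Z j ω ^ 4 ∂μ ≤ C) (m : ℕ) :
    ∫ ω, (∑ j ∈ Finset.range m, Z j ω) ^ 4 ∂μ ≤ 3 * (1 + C) ^ 2 * m ^ 2 := by
  suffices h : ∫ ω, (∑ j ∈ Finset.range m, Z j ω) ^ 2 ∂μ ≤ (1 + C) * m ∧
      ∫ ω, (∑ j ∈ Finset.range m, Z j ω) ^ 4 ∂μ ≤ 3 * (1 + C) ^ 2 * m ^ 2 from h.2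
  induction m with
  | zero => simp
  | succ m ih =>
    obtain ⟨ih2, ih4⟩ := ih
    set S : Ω → ℝ := fun ω => ∑ j ∈ Finset.range m, Z j ω with hS
    have hSL : MemLp S 4 μ := memLp_finsetSum _ fun j _ => hL j
    have hSm : Measurable S := Finset.measurable_sum _ fun j _ => hmeas j
    have hSZ : IndepFun S (Z m) μ := by
      have := hind.indepFun_sum_range_succ hmeas m
      convert this using 1
      funext ω
      simp [hS]
    have hS0 : ∫ ω, S ω ∂μ = 0 := by
      rw [hS, integral_finsetSum _ fun j _ => (hL j).integrable (by norm_num)]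
      exact Finset.sum_eq_zero fun j _ => h0 j
    have hZ2 : ∫ ω, Z m ω ^ 2 ∂μ ≤ 1 + C := by
      calc ∫ ω, Z m ω ^ 2 ∂μ ≤ ∫ ω, (1 + Z m ω ^ 4) ∂μ := by
            refine integral_mono (integrable_pow_of_memLp_four (hL m) (by norm_num))
              ((integrable_const _).add (integrable_pow_of_memLp_four (hL m) le_rfl)) fun ω => ?_
            change Z m ω ^ 2 ≤ 1 + Z m ω ^ 4
            nlinarith [sq_nonneg (Z m ω ^ 2 - 1)]
        _ ≤ 1 + C := by
            rw [integral_add (integrable_const _) (integrable_pow_of_memLp_four (hL m) le_rfl)]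
            simpa using hC m
    have hind_pow : ∀ a b : ℕ, IndepFun (fun ω => S ω ^ a) (fun ω => Z m ω ^ b) μ := fun a b =>
      hSZ.comp (φ := fun x : ℝ => x ^ a) (ψ := fun x : ℝ => x ^ b) (by fun_prop) (by fun_prop)
    have hmul : ∀ a b : ℕ, a ≤ 4 → b ≤ 4 → Integrable (fun ω => S ω ^ a * Z m ω ^ b) μ ∧
        ∫ ω, S ω ^ a * Z m ω ^ b ∂μ = (∫ ω, S ω ^ a ∂μ) * ∫ ω, Z m ω ^ b ∂μ := fun a b ha hb =>
      ⟨(hind_pow a b).integrable_mul (integrable_pow_of_memLp_four hSL ha)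
        (integrable_pow_of_memLp_four (hL m) hb),
       (hind_pow a b).integral_fun_mul_eq_mul_integral (hSm.pow_const a).aestronglyMeasurable
        ((hmeas m).pow_const b).aestronglyMeasurable⟩
    have i40 := integrable_pow_of_memLp_four hSL le_rfl
    have i20 := integrable_pow_of_memLp_four hSL (k := 2) (by norm_num)
    have z40 := integrable_pow_of_memLp_four (hL m) le_rfl
    have z20 := integrable_pow_of_memLp_four (hL m) (k := 2) (by norm_num)
    obtain ⟨i11, e11⟩ := hmul 1 1 (by norm_num) (by norm_num)
    obtain ⟨i31, e31⟩ := hmul 3 1 (by norm_num) (by norm_num)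
    obtain ⟨i22, e22⟩ := hmul 2 2 (by norm_num) (by norm_num)
    obtain ⟨i13, e13⟩ := hmul 1 3 (by norm_num) (by norm_num)
    simp only [pow_one, hS0, h0, mul_zero, zero_mul] at i11 e11 i31 e31 i13 e13
    have E2 : ∫ ω, (S ω + Z m ω) ^ 2 ∂μ = ∫ ω, S ω ^ 2 ∂μ + ∫ ω, Z m ω ^ 2 ∂μ := by
      have : ∀ ω, (S ω + Z m ω) ^ 2 = (S ω ^ 2 + 2 * (S ω * Z m ω)) + Z m ω ^ 2 :=
        fun ω => by ring
      have j1 : Integrable (fun ω => S ω ^ 2 + 2 * (S ω * Z m ω)) μ := i20.add (i11.const_mul 2)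
      simp_rw [this]
      rw [integral_add j1 z20, integral_add i20 (i11.const_mul 2),
        integral_const_mul, e11]
      ring
    have E4 : ∫ ω, (S ω + Z m ω) ^ 4 ∂μ = ∫ ω, S ω ^ 4 ∂μ +
        6 * ((∫ ω, S ω ^ 2 ∂μ) * ∫ ω, Z m ω ^ 2 ∂μ) + ∫ ω, Z m ω ^ 4 ∂μ := by
      have : ∀ ω, (S ω + Z m ω) ^ 4 = (((S ω ^ 4 + 4 * (S ω ^ 3 * Z m ω)) +
          6 * (S ω ^ 2 * Z m ω ^ 2)) + 4 * (S ω * Z m ω ^ 3)) + Z m ω ^ 4 :=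
        fun ω => by ring
      have j1 : Integrable (fun ω => S ω ^ 4 + 4 * (S ω ^ 3 * Z m ω)) μ :=
        i40.add (i31.const_mul 4)
      have j2 : Integrable (fun ω => S ω ^ 4 + 4 * (S ω ^ 3 * Z m ω) +
          6 * (S ω ^ 2 * Z m ω ^ 2)) μ := j1.add (i22.const_mul 6)
      have j3 : Integrable (fun ω => S ω ^ 4 + 4 * (S ω ^ 3 * Z m ω) +
          6 * (S ω ^ 2 * Z m ω ^ 2) + 4 * (S ω * Z m ω ^ 3)) μ := j2.add (i13.const_mul 4)
      simp_rw [this]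
      rw [integral_add j3 z40, integral_add j2 (i13.const_mul 4),
        integral_add j1 (i22.const_mul 6), integral_add i40 (i31.const_mul 4),
        integral_const_mul, integral_const_mul, integral_const_mul, e31, e22, e13]
      ring
    have hS2 : 0 ≤ ∫ ω, S ω ^ 2 ∂μ := integral_nonneg fun ω => by positivity
    have hZ2' : 0 ≤ ∫ ω, Z m ω ^ 2 ∂μ := integral_nonneg fun ω => by positivity
    have hm : (0 : ℝ) ≤ m := Nat.cast_nonneg m
    simp_rw [Finset.sum_range_succ]
    push_cast
    refine ⟨?_, ?_⟩
    · refine le_of_eq_of_le E2 ?_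
      nlinarith
    · refine le_of_eq_of_le E4 ?_
      have h1 : (∫ ω, S ω ^ 2 ∂μ) * ∫ ω, Z m ω ^ 2 ∂μ ≤ ((1 + C) * m) * (1 + C) :=
        mul_le_mul ih2 hZ2 hZ2' (by positivity)
      have h2 := hC m
      nlinarith [sq_nonneg C]

/-! ### The log-likelihood random walk after the change -/

lemma iIndepFun_eval_P (ν : ℕ∞) : iIndepFun (fun (i : ℕ) (ω : Obs) => ω i) (P g f ν) :=
  iIndepFun_infinitePi (X := fun _ x => x) fun _ => measurable_id

lemma measurePreserving_X_P {ν : ℕ} (hν : 1 ≤ ν) (j : ℕ) :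
    MeasurePreserving (X (ν + j)) (P g f ν) (f j).law := by
  have h := measurePreserving_eval_infinitePi
    (fun i : ℕ => (obsDensity g f ν (i + 1)).law) (ν + j - 1)
  have h2 : obsDensity g f ν (ν + j - 1 + 1) = f j := by
    rw [obsDensity_of_le g f (by omega)]
    congr 1
    omega
  simp only [h2] at h
  exact h

lemma coe_sum_ereal (s : Finset ℕ) (a : ℕ → ℝ) :
    ((∑ i ∈ s, a i : ℝ) : EReal) = ∑ i ∈ s, (a i : EReal) := by
  classical
  induction s using Finset.induction_on with
  | empty => simp
  | insert i s hi ih => rw [Finset.sum_insert hi, Finset.sum_insert hi, EReal.coe_add, ih]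

/-- The sum of the first `m` divergences, which is the mean under `P_ν` of the log-likelihood ratio
of `m` observations from the change point on. -/
noncomputable def drift (g : ProbDensity) (f : ℕ → ProbDensity) (m : ℕ) : ℝ :=
  ∑ j ∈ Finset.range m, (divergence (f j) g).toReal

/-- The constant in the tail bound for the log-likelihood random walk, for fourth central moments
bounded by `C` and deviations at rate `c`. -/
noncomputable def tailConst (C : ℝ≥0) (c : ℝ) : ℝ := 3 * (1 + (C : ℝ)) ^ 2 / c ^ 4

section RandomWalk

variable (h : ∀ n, ∫⁻ x, (logLR (f n) g x).abs ^ 4 ∂(f n).law < ∞) {C : ℝ≥0}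
  (hC : ∀ n, ∫⁻ x, (logLR (f n) g x - (divergence (f n) g : EReal)).abs ^ 4 ∂(f n).law ≤ C)

include h hC in
lemma measure_le_abs_sum_sub_drift_le {ν m : ℕ} (hν : 1 ≤ ν) (hm : 1 ≤ m) {c : ℝ} (hc : 0 < c) :
    P g f ν {ω | c * m ≤ |∑ j ∈ Finset.range m, realLogLR (f j) g (X (ν + j) ω) - drift g f m|} ≤
      ENNReal.ofReal (tailConst C c / m ^ 2) := by
  let z : ℕ → ℝ → ℝ := fun j x => realLogLR (f j) g x - (divergence (f j) g).toReal
  let Z : ℕ → Obs → ℝ := fun j ω => z j (X (ν + j) ω)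
  have hz : ∀ j, Measurable (z j) := fun j => (measurable_realLogLR _ _).sub_const _
  have hZ : ∀ j, Measurable (Z j) := fun j => (hz j).comp (measurable_X _)
  have hmp := fun j => measurePreserving_X_P (g := g) (f := f) hν j
  have hzL : ∀ j, MemLp (z j) 4 (f j).law := fun j =>
    (memLp_realLogLR (h j)).sub (memLp_const _)
  have hZL : ∀ j, MemLp (Z j) 4 (P g f ν) := fun j => (hzL j).comp_measurePreserving (hmp j)
  have hint : ∀ j (φ : ℝ → ℝ), Measurable φ →
      ∫ ω, φ (Z j ω) ∂(P g f ν) = ∫ x, φ (z j x) ∂(f j).law := by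
    intro j φ hφ
    rw [← (hmp j).map_eq]
    exact (integral_map (f := fun x => φ (z j x)) (measurable_X _).aemeasurable
      (hφ.comp (hz j)).aestronglyMeasurable).symm
  have hZ0 : ∀ j, ∫ ω, Z j ω ∂(P g f ν) = 0 := by
    intro j
    rw [hint j (fun x => x) measurable_id, integral_sub (integrable_realLogLR (h j))
      (integrable_const _), integral_realLogLR (h j)]
    simp
  have hZ4 : ∀ j, ∫ ω, Z j ω ^ 4 ∂(P g f ν) ≤ C := by
    intro j
    rw [hint j (fun x => x ^ 4) (by fun_prop)]
    exact integral_centered_pow_four_le (h j) (hC j)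
  have hind : iIndepFun Z (P g f ν) := by
    have h1 := (iIndepFun_eval_P (g := g) (f := f) (ν : ℕ∞)).precomp
      (g := fun j : ℕ => ν + j - 1) (fun a b (hab : ν + a - 1 = ν + b - 1) => by omega)
    exact h1.comp z hz
  have h4 := integral_sum_pow_four_le hind hZ hZL hZ0 C.coe_nonneg hZ4 m
  have hsum : ∀ ω, ∑ j ∈ Finset.range m, Z j ω =
      ∑ j ∈ Finset.range m, realLogLR (f j) g (X (ν + j) ω) - drift g f m := by
    intro ω
    rw [drift, ← Finset.sum_sub_distrib]
  simp_rw [hsum] at h4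
  have hL4 : MemLp (fun ω => ∑ j ∈ Finset.range m, realLogLR (f j) g (X (ν + j) ω)
      - drift g f m) 4 (P g f ν) := by
    simp_rw [← hsum]
    exact memLp_finsetSum _ fun j _ => hZL j
  have hmk := mul_meas_ge_le_integral_of_nonneg (ae_of_all _ fun ω => by positivity)
    (integrable_pow_of_memLp_four hL4 le_rfl) ((c * m) ^ 4)
  have hm0 : (0 : ℝ) < m := by exact_mod_cast hm
  have hcm : 0 < (c * m) ^ 4 := by positivity
  rw [← ofReal_measureReal]
  refine ENNReal.ofReal_le_ofReal ?_
  have hsub : {ω | c * m ≤ |∑ j ∈ Finset.range m, realLogLR (f j) g (X (ν + j) ω)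
      - drift g f m|} ⊆ {ω | (c * m) ^ 4 ≤ (∑ j ∈ Finset.range m,
      realLogLR (f j) g (X (ν + j) ω) - drift g f m) ^ 4} := by
    intro ω (hω : c * m ≤ _)
    change (c * m) ^ 4 ≤ _
    rw [← (by decide : Even 4).pow_abs (∑ j ∈ Finset.range m, _ - _)]
    gcongr
  refine (measureReal_mono hsub).trans ?_
  have h5 := hmk.trans h4
  rw [← le_div_iff₀' hcm] at h5
  refine h5.trans (le_of_eq ?_)
  rw [tailConst]
  field_simp

include h in
/-- Under `P_ν` the log-likelihood ratio of the first `m` observations from the change point on is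
almost surely a sum of real numbers. -/
lemma log_pathLR_ae_eq {ν m : ℕ} (hν : 1 ≤ ν) (hm : 1 ≤ m) :
    ∀ᵐ ω ∂(P g f ν), ENNReal.log (pathLR g f ν (ν + m - 1) ω) =
      ((∑ j ∈ Finset.range m, realLogLR (f j) g (X (ν + j) ω) : ℝ) : EReal) := by
  have h1 : ∀ᵐ ω ∂(P g f ν), ∀ j,
      (realLogLR (f j) g (X (ν + j) ω) : EReal) = logLR (f j) g (X (ν + j) ω) :=
    ae_all_iff.2 fun j =>
      (measurePreserving_X_P hν j).quasiMeasurePreserving.ae (ae_coe_realLogLR_eq (h j))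
  filter_upwards [h1] with ω hω
  rw [pathLR, log_prod_eq_sum_log, coe_sum_ereal]
  simp_rw [hω]
  refine (Finset.sum_bij (fun j _ => ν + j) ?_ ?_ ?_ ?_).symm
  · intro j hj; rw [Finset.mem_range] at hj; rw [Finset.mem_Icc]; omega
  · intro i _ j _ hij; omega
  · intro i hi
    rw [Finset.mem_Icc] at hi
    exact ⟨i - ν, by rw [Finset.mem_range]; omega, by omega⟩
  · intro j _
    rw [Nat.add_sub_cancel_left, logLR_eq_log_likelihoodRatio]

include h hC in
lemma measure_pathLR_le_le {ν m : ℕ} (hν : 1 ≤ ν) (hm : 1 ≤ m) {c A : ℝ} (hc : 0 < c)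
    (hA : A + c * m ≤ drift g f m) :
    P g f ν {ω | pathLR g f ν (ν + m - 1) ω ≤ ENNReal.ofReal (Real.exp A)} ≤
      ENNReal.ofReal (tailConst C c / m ^ 2) := by
  refine le_trans (measure_mono_ae ?_) (measure_le_abs_sum_sub_drift_le h hC hν hm hc)
  filter_upwards [log_pathLR_ae_eq h hν hm] with ω hω (hle : pathLR g f ν (ν + m - 1) ω ≤ _)
  rw [← ENNReal.log_le_log_iff, hω, ENNReal.log_ofReal_of_pos (Real.exp_pos _), Real.log_exp,
    EReal.coe_le_coe_iff] at hle
  change c * m ≤ _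
  rw [abs_sub_comm]
  exact le_trans (by linarith) (le_abs_self _)

include h hC in
lemma measure_lt_pathLR_le {ν m : ℕ} (hν : 1 ≤ ν) (hm : 1 ≤ m) {c A : ℝ} (hc : 0 < c)
    (hA : drift g f m + c * m ≤ A) :
    P g f ν {ω | ENNReal.ofReal (Real.exp A) < pathLR g f ν (ν + m - 1) ω} ≤
      ENNReal.ofReal (tailConst C c / m ^ 2) := by
  refine le_trans (measure_mono_ae ?_) (measure_le_abs_sum_sub_drift_le h hC hν hm hc)
  filter_upwards [log_pathLR_ae_eq h hν hm] with ω hω (hle : _ < pathLR g f ν (ν + m - 1) ω)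
  rw [← ENNReal.log_lt_log_iff, hω, ENNReal.log_ofReal_of_pos (Real.exp_pos _), Real.log_exp,
    EReal.coe_lt_coe_iff] at hle
  change c * m ≤ _
  exact le_trans (by linarith) (le_abs_self _)

end RandomWalk

/-! ### Independence of past and future -/

/-- The σ-algebra generated by the observations `X_n` with `n ≥ ν`, `n ≥ 1`. -/
@[reducible]
def futureSigma (ν : ℕ) : MeasurableSpace Obs :=
  ⨆ i ∈ {i : ℕ | ν ≤ i + 1}, MeasurableSpace.comap (fun ω : Obs => ω i) inferInstance

lemma futureSigma_le (ν : ℕ) : futureSigma ν ≤ (inferInstance : MeasurableSpace Obs) :=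
  iSup₂_le fun i _ => (measurable_pi_apply i).comap_le

lemma indep_obsFiltration_futureSigma {ν : ℕ} (hν : 1 ≤ ν) (ν' : ℕ∞) :
    Indep (obsFiltration (ν - 1)) (futureSigma ν) (P g f ν') := by
  have h1 := indep_iSup_of_disjoint (fun i => (measurable_pi_apply i).comap_le)
    (iIndepFun_eval_P (g := g) (f := f) ν').iIndep
    (S := {i : ℕ | i + 1 < ν}) (T := {i : ℕ | ν ≤ i + 1})
    (Set.disjoint_left.2 fun i (hi : i + 1 < ν) (hi' : ν ≤ i + 1) => by omega)
  refine indep_of_indep_of_le_left h1 ?_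
  refine iSup₂_le fun i hi => ?_
  rw [Finset.mem_Icc] at hi
  exact le_iSup₂ (f := fun i (_ : i ∈ {i : ℕ | i + 1 < ν}) =>
    MeasurableSpace.comap (fun ω : Obs => ω i) inferInstance) (i - 1)
    (show i - 1 + 1 < ν by omega)

lemma measurable_pathLR_futureSigma {ν n : ℕ} (hν : 1 ≤ ν) :
    Measurable[futureSigma ν] (pathLR g f ν n) := by
  refine Finset.measurable_prod _ fun i hi => (measurable_likelihoodRatio _ _).comp ?_
  rw [Finset.mem_Icc] at hi
  refine measurable_iff_comap_le.2 ?_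
  exact le_iSup₂ (f := fun i (_ : i ∈ {i : ℕ | ν ≤ i + 1}) =>
    MeasurableSpace.comap (fun ω : Obs => ω i) inferInstance) (i - 1)
    (show ν ≤ i - 1 + 1 by omega)

lemma measurable_pathLR_obsFiltration {ν n : ℕ} (hν : 1 ≤ ν) :
    Measurable[obsFiltration n] (pathLR g f ν n) := by
  refine Finset.measurable_prod _ fun i hi => (measurable_likelihoodRatio _ _).comp ?_
  rw [Finset.mem_Icc] at hi
  refine measurable_iff_comap_le.2 ?_
  exact le_iSup₂ (f := fun i (_ : i ∈ Finset.Icc 1 n) =>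
    MeasurableSpace.comap (X i) inferInstance) i (Finset.mem_Icc.2 ⟨by omega, hi.2⟩)

/-- A conditional expectation is bounded by the mean of any larger variable that is independent of
the conditioning. -/
lemma condLExp_le_lintegral_of_indep {Ω : Type*} {m m' mΩ : MeasurableSpace Ω} {μ : Measure Ω}
    [IsProbabilityMeasure μ] (hm : m ≤ mΩ) (hm' : m' ≤ mΩ) (hind : Indep m m' μ)
    {Y Y' : Ω → ℝ≥0∞} (hYY' : ∀ ω, Y ω ≤ Y' ω) (hY' : Measurable[m'] Y') :
    ∀ᵐ ω ∂μ, condLExp m μ Y ω ≤ ∫⁻ ω, Y' ω ∂μ := by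
  refine ae_of_ae_trim hm ?_
  refine ae_le_of_forall_setLIntegral_le_of_sigmaFinite (measurable_condLExp m μ Y)
    fun s hs _ => ?_
  rw [setLIntegral_condLExp_trim hm μ Y hs, setLIntegral_const, trim_measurableSet_eq hm hs]
  calc ∫⁻ ω in s, Y ω ∂μ ≤ ∫⁻ ω in s, Y' ω ∂μ := lintegral_mono hYY'
    _ = ∫⁻ ω, s.indicator 1 ω * Y' ω ∂μ := by
        rw [← lintegral_indicator (hm s hs)]
        refine lintegral_congr fun ω => ?_
        by_cases h : ω ∈ s <;> simp [h]
    _ = (∫⁻ ω, Y' ω ∂μ) * μ s := by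
        rw [lintegral_mul_eq_lintegral_mul_lintegral_of_independent_measurableSpace hm hm' hind
          (show Measurable[m] (s.indicator (1 : Ω → ℝ≥0∞)) from
            Measurable.indicator (measurable_const (a := (1 : ℝ≥0∞))) hs) hY', lintegral_indicator_one (hm s hs), mul_comm]

/-! ### The delay of EX-CUSUM -/

/-- After the change, EX-CUSUM stops no later than the first time the likelihood ratio of the
observations since `ν` exceeds the threshold, so its delay is at most the number of `m` for which
this ratio has not exceeded the threshold. The first `N` values of `m` are all counted, so that tail
bounds are needed for `m ≥ N` only. -/
lemma exCusum_add_one_sub_le {γ : ℝ} (hγ : 0 < γ) {ν N : ℕ} (hν : 1 ≤ ν) (hN : 1 ≤ N) (ω : Obs) :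
    (exCusum g f (Real.log γ) ω : ℝ≥0∞) + 1 - (ν : ℝ≥0∞) ≤
      ∑' m : ℕ, ((if m < N then 1 else 0) + {ω | N ≤ m ∧
        pathLR g f ν (ν + m - 1) ω ≤ ENNReal.ofReal γ}.indicator 1 ω) := by
  set t := exCusum g f (Real.log γ) ω
  have h1 : (t : ℝ≥0∞) + 1 - (ν : ℝ≥0∞) = ((t + 1 - (ν : ℕ∞) : ℕ∞) : ℝ≥0∞) := by simp
  rw [h1, coe_enat_eq_tsum]
  refine ENNReal.tsum_le_tsum fun m => ?_
  by_cases hmN : m < N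
  · rw [if_pos hmN]
    exact le_add_right (by split_ifs <;> simp)
  · by_cases hle : ((m + 1 : ℕ) : ℕ∞) ≤ t + 1 - (ν : ℕ∞)
    · rw [if_pos hle, if_neg hmN, zero_add, Set.indicator_of_mem]
      · rfl
      refine ⟨not_lt.1 hmN, ?_⟩
      by_contra! hlt
      have h2 : t ≤ ((ν + m - 1 : ℕ) : ℕ∞) := exCusum_le_iff.2 ⟨ν + m - 1, by omega, le_rfl,
        (lt_exCusumStat_iff hγ).2 ⟨ν, Finset.mem_Icc.2 ⟨hν, by omega⟩, hlt⟩⟩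
      obtain ⟨k, hk⟩ := ENat.ne_top_iff_exists.1
        (ne_top_of_le_ne_top (ENat.natCast_ne_top _) h2)
      rw [← hk] at hle h2
      norm_cast at hle h2
      omega
    · rw [if_neg hle]
      exact zero_le

lemma measurable_tsum_add_indicator {Ω : Type*} {mΩ : MeasurableSpace Ω} (a : ℕ → ℝ≥0∞)
    {E : ℕ → Set Ω} (hE : ∀ m, MeasurableSet (E m)) :
    Measurable fun ω => ∑' m : ℕ, (a m + (E m).indicator 1 ω) :=
  Measurable.tsum fun m => measurable_const.add (measurable_one.indicator (hE m))

lemma lordenDelay_exCusum_le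
    (h : ∀ n, ∫⁻ x, (logLR (f n) g x).abs ^ 4 ∂(f n).law < ∞) {C : ℝ≥0}
    (hC : ∀ n, ∫⁻ x, (logLR (f n) g x - (divergence (f n) g : EReal)).abs ^ 4 ∂(f n).law ≤ C)
    {γ c : ℝ} (hγ : 0 < γ) (hc : 0 < c) {N : ℕ} (hN : 1 ≤ N)
    (hdrift : ∀ m : ℕ, N ≤ m → Real.log γ + c * m ≤ drift g f m) :
    lordenDelay g f (exCusum g f (Real.log γ)) ≤
      N + ∑' m : ℕ, ENNReal.ofReal (tailConst C c / (m : ℝ) ^ 2) := by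
  refine iSup₂_le fun ν hν => essSup_le_of_ae_le _ ?_
  let E : ℕ → Set Obs := fun m => {ω | N ≤ m ∧
    pathLR g f ν (ν + m - 1) ω ≤ ENNReal.ofReal γ}
  have hE : ∀ m, MeasurableSet[futureSigma ν] (E m) := by
    intro m
    by_cases hm : N ≤ m
    · simpa [E, hm] using measurableSet_le (measurable_pathLR_futureSigma hν)
        (measurable_const (a := ENNReal.ofReal γ))
    · simp [E, hm]
  have hmeas : Measurable[futureSigma ν] fun ω => ∑' m : ℕ,
      ((if m < N then (1 : ℝ≥0∞) else 0) + (E m).indicator 1 ω) :=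
    measurable_tsum_add_indicator (fun m => if m < N then 1 else 0) hE
  filter_upwards [condLExp_le_lintegral_of_indep (obsFiltration.le _) (futureSigma_le ν)
    (indep_obsFiltration_futureSigma (g := g) (f := f) hν ν)
    (exCusum_add_one_sub_le (g := g) (f := f) hγ hν hN) hmeas] with ω hω
  refine hω.trans ?_
  change ∫⁻ ω, ∑' m : ℕ, ((if m < N then (1 : ℝ≥0∞) else 0) + (E m).indicator 1 ω) ∂_ ≤ _
  rw [lintegral_tsum (f := fun m ω => (if m < N then (1 : ℝ≥0∞) else 0) + (E m).indicator 1 ω)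
    fun m => (measurable_const.add (measurable_one.indicator
    (futureSigma_le ν _ (hE m)))).aemeasurable]
  have hN' : (N : ℝ≥0∞) = ∑' m : ℕ, if m < N then (1 : ℝ≥0∞) else 0 := by
    rw [tsum_eq_sum (s := Finset.range N) (by intro m hm; simpa using hm),
      Finset.sum_congr rfl (g := fun _ => (1 : ℝ≥0∞)) (by intro m hm; simpa using hm)]
    simp
  rw [hN', ← ENNReal.tsum_add]
  refine ENNReal.tsum_le_tsum fun m => ?_
  rw [lintegral_add_left measurable_const,
    lintegral_indicator_one (futureSigma_le ν _ (hE m)), lintegral_const, measure_univ, mul_one]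
  gcongr
  by_cases hm : N ≤ m
  · have h1 := measure_pathLR_le_le h hC hν (hN.trans hm) hc (hdrift m hm)
    rw [Real.exp_log hγ] at h1
    exact (measure_mono fun ω hω => hω.2).trans h1
  · simp [E, hm]

/-! ### Pollak's delay is at most Lorden's -/

lemma pollakDelay_le_lordenDelay {τ : Obs → ℕ∞} (hτ : IsStoppingTime obsFiltration τ) :
    pollakDelay g f τ ≤ lordenDelay g f τ := by
  refine iSup₂_mono fun ν hν => ?_
  set s : Set Obs := {ω | (ν : ℕ∞) ≤ τ ω}
  have hsm : MeasurableSet[obsFiltration (ν - 1)] s := measurableSet_natCast_le hτ (by omega)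
  rw [ProbabilityTheory.cond, lintegral_smul_measure, smul_eq_mul]
  by_cases h0 : P g f ν s = 0
  · simp [Measure.restrict_eq_zero.2 h0]
  set Y : Obs → ℝ≥0∞ := fun ω => (τ ω : ℝ≥0∞) + 1 - (ν : ℝ≥0∞)
  set M := essSup (condLExp (obsFiltration (ν - 1)) (P g f ν) Y) (P g f ν)
  have h1 : ∫⁻ ω in s, ((τ ω : ℝ≥0∞) - (ν : ℝ≥0∞)) ∂(P g f ν) ≤ M * P g f ν s := by
    calc ∫⁻ ω in s, ((τ ω : ℝ≥0∞) - (ν : ℝ≥0∞)) ∂(P g f ν)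
        ≤ ∫⁻ ω in s, Y ω ∂(P g f ν) :=
          lintegral_mono fun ω => tsub_le_tsub_right le_self_add _
      _ = ∫⁻ ω in s, condLExp (obsFiltration (ν - 1)) (P g f ν) Y ω ∂(P g f ν) :=
          (setLIntegral_condLExp (obsFiltration.le _) _ _ hsm).symm
      _ ≤ ∫⁻ _ in s, M ∂(P g f ν) :=
          lintegral_mono_ae (ae_restrict_of_ae (ENNReal.ae_le_essSup _))
      _ = M * P g f ν s := setLIntegral_const _ _
  calc (P g f ν s)⁻¹ * ∫⁻ ω in s, ((τ ω : ℝ≥0∞) - (ν : ℝ≥0∞)) ∂(P g f ν)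
      ≤ (P g f ν s)⁻¹ * (M * P g f ν s) := by gcongr
    _ = M := by
        rw [mul_comm M, ← mul_assoc, ENNReal.inv_mul_cancel h0 (measure_ne_top _ _), one_mul]

/-! ### The lower bound on Pollak's delay -/

/-- If `E_∞ τ ≥ γ` then there is a time `ν` that `τ` reaches with positive probability and such
that `τ` is unlikely to stop within the `m` steps from `ν` on. Otherwise summing over `ν`, with
each stopping time counted in at most `m` windows, contradicts `∑ P_∞(τ ≥ ν) = E_∞ τ ≥ γ`. -/
lemma exists_window {τ : Obs → ℕ∞} (hτ : IsStoppingTime obsFiltration τ) {γ : ℝ} (hγ : 0 < γ)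
    (hE : ENNReal.ofReal γ ≤ ∫⁻ ω, (τ ω : ℝ≥0∞) ∂(P g f ⊤)) {m : ℕ} (hm : 1 ≤ m) :
    ∃ ν : ℕ, 1 ≤ ν ∧ P g f ⊤ {ω | (ν : ℕ∞) ≤ τ ω} ≠ 0 ∧
      P g f ⊤ {ω | (ν : ℕ∞) ≤ τ ω ∧ ¬ ((ν + m : ℕ) : ℕ∞) ≤ τ ω} ≤
        ENNReal.ofReal (2 * m / γ) * P g f ⊤ {ω | (ν : ℕ∞) ≤ τ ω} := by
  by_contra! hcon
  let B : ℕ → Set Obs := fun ν => {ω | (ν : ℕ∞) ≤ τ ω ∧ ¬ ((ν + m : ℕ) : ℕ∞) ≤ τ ω}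
  have hBm : ∀ ν, MeasurableSet (B ν) := fun ν =>
    (obsFiltration.le _ _ (measurableSet_natCast_le hτ (n := ν) (by omega))).inter
      (obsFiltration.le _ _ (measurableSet_natCast_le hτ (n := ν + m) (by omega))).compl
  have h1 : ∀ n : ℕ, ENNReal.ofReal (2 * m / γ) * P g f ⊤ {ω | ((n + 1 : ℕ) : ℕ∞) ≤ τ ω} ≤
      P g f ⊤ (B (n + 1)) := by
    intro n
    by_cases h0 : P g f ⊤ {ω | ((n + 1 : ℕ) : ℕ∞) ≤ τ ω} = 0
    · rw [h0, mul_zero]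
      exact zero_le
    · simp only [B, not_le]
      exact (hcon (n + 1) (by omega) h0).le
  have h2 : ∑' n : ℕ, P g f ⊤ (B (n + 1)) ≤ m := by
    have h3 : ∀ ω, ∑' n : ℕ, (B (n + 1)).indicator (1 : Obs → ℝ≥0∞) ω ≤ m := by
      intro ω
      by_cases htop : τ ω = ⊤
      · have : ∀ n, (B (n + 1)).indicator (1 : Obs → ℝ≥0∞) ω = 0 := fun n =>
          Set.indicator_of_notMem (fun hω => hω.2 (by rw [htop]; exact le_top)) _
        simp [this]
      obtain ⟨k, hk⟩ := ENat.ne_top_iff_exists.1 htop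
      rw [tsum_eq_sum (s := Finset.Ico (k - m) k)]
      · refine (Finset.sum_le_card_nsmul _ _ 1 fun n _ => ?_).trans ?_
        · exact Set.indicator_le_self' (fun _ _ => zero_le) ω
        · rw [Nat.card_Ico, nsmul_eq_mul, mul_one]
          exact_mod_cast (by omega : k - (k - m) ≤ m)
      · intro n hn
        refine Set.indicator_of_notMem (fun hω => hn ?_) _
        obtain ⟨ha, hb⟩ := hω
        rw [← hk] at ha hb
        norm_cast at ha hb
        rw [Finset.mem_Ico]
        omega
    calc ∑' n : ℕ, P g f ⊤ (B (n + 1))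
        = ∫⁻ ω, ∑' n : ℕ, (B (n + 1)).indicator 1 ω ∂(P g f ⊤) := by
          rw [lintegral_tsum fun n => (measurable_one.indicator (hBm _)).aemeasurable]
          exact tsum_congr fun n => (lintegral_indicator_one (hBm _)).symm
      _ ≤ ∫⁻ _, (m : ℝ≥0∞) ∂(P g f ⊤) := lintegral_mono h3
      _ = m := by simp
  have h4 : ENNReal.ofReal (2 * m / γ) * ENNReal.ofReal γ ≤ m := by
    refine le_trans ?_ h2
    refine (mul_le_mul_right hE _).trans ?_
    rw [lintegral_stoppingTime_eq_tsum hτ, ← ENNReal.tsum_mul_left]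
    exact ENNReal.tsum_le_tsum h1
  rw [← ENNReal.ofReal_mul (by positivity), div_mul_cancel₀ _ hγ.ne',
    ← ENNReal.ofReal_natCast m, ENNReal.ofReal_le_ofReal_iff (by positivity)] at h4
  have : (1 : ℝ) ≤ m := by exact_mod_cast hm
  linarith

/-- A change of measure bounds Pollak's delay of a stopping time with `E_∞ τ ≥ γ` from below: in
the window of `exists_window`, `τ` cannot stop with substantial probability under `P_ν` unless the
likelihood ratio over the window exceeds `exp b`. -/
lemma le_pollakDelay
    (hac : ∀ n, (f n).law = g.law.withDensity (likelihoodRatio (f n) g))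
    {τ : Obs → ℕ∞} (hτ : IsStoppingTime obsFiltration τ) {γ : ℝ} (hγ : 0 < γ)
    (hE : ENNReal.ofReal γ ≤ ∫⁻ ω, (τ ω : ℝ≥0∞) ∂(P g f ⊤)) {m : ℕ} (hm : 1 ≤ m) {b : ℝ}
    {q : ℝ≥0∞} (hq : ∀ ν : ℕ, 1 ≤ ν →
      P g f ν {ω | ENNReal.ofReal (Real.exp b) < pathLR g f ν (ν + m - 1) ω} ≤ q) :
    m * (1 - (ENNReal.ofReal (Real.exp b) * ENNReal.ofReal (2 * m / γ) + q)) ≤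
      pollakDelay g f τ := by
  obtain ⟨ν, hν, ha, hwin⟩ := exists_window hτ hγ hE hm
  set r := ENNReal.ofReal (Real.exp b) * ENNReal.ofReal (2 * m / γ) + q with hr
  set s : Set Obs := {ω | (ν : ℕ∞) ≤ τ ω}
  set u : Set Obs := {ω | ((ν + m : ℕ) : ℕ∞) ≤ τ ω}
  set B : Set Obs := {ω | (ν : ℕ∞) ≤ τ ω ∧ ¬ ((ν + m : ℕ) : ℕ∞) ≤ τ ω}
  set G : Set Obs := {ω | ENNReal.ofReal (Real.exp b) < pathLR g f ν (ν + m - 1) ω}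
  have hsm : MeasurableSet[obsFiltration (ν - 1)] s := measurableSet_natCast_le hτ (by omega)
  have hum : MeasurableSet[obsFiltration (ν + m - 1)] u := measurableSet_natCast_le hτ (by omega)
  have hBm : MeasurableSet[obsFiltration (ν + m - 1)] B :=
    (obsFiltration.mono (by omega : ν - 1 ≤ ν + m - 1) _ hsm).inter hum.compl
  have hGm : MeasurableSet[obsFiltration (ν + m - 1)] G :=
    measurableSet_lt measurable_const (measurable_pathLR_obsFiltration hν)
  have hGf : MeasurableSet[futureSigma ν] G :=
    measurableSet_lt measurable_const (measurable_pathLR_futureSigma hν)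
  have hsν : P g f ν s = P g f ⊤ s := P_apply_eq_P_top_apply (by omega) hsm
  have h1 : P g f ν (B \ G) ≤
      ENNReal.ofReal (Real.exp b) * (ENNReal.ofReal (2 * m / γ) * P g f ν s) := by
    rw [P_apply_eq_setLIntegral_pathLR hac hν (hBm.diff hGm), hsν]
    calc ∫⁻ ω in B \ G, pathLR g f ν (ν + m - 1) ω ∂(P g f ⊤)
        ≤ ∫⁻ _ in B \ G, ENNReal.ofReal (Real.exp b) ∂(P g f ⊤) :=
          setLIntegral_mono' (obsFiltration.le _ _ (hBm.diff hGm)) fun ω hω => not_lt.1 hω.2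
      _ = ENNReal.ofReal (Real.exp b) * P g f ⊤ (B \ G) := setLIntegral_const _ _
      _ ≤ _ := by
          gcongr
          exact (measure_mono Set.sdiff_subset).trans hwin
  have h2 : P g f ν (s ∩ G) ≤ P g f ν s * q := by
    rw [(Indep_iff _ _ _).1 (indep_obsFiltration_futureSigma hν ν) s G hsm hGf]
    gcongr
    exact hq ν hν
  have h3 : P g f ν s * (1 - r) ≤ P g f ν u := by
    have hsub : s ⊆ (B \ G) ∪ (s ∩ G) ∪ u := by
      intro ω hω
      by_cases hωu : ω ∈ u
      · exact Or.inr hωu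
      · by_cases hωG : ω ∈ G
        · exact Or.inl (Or.inr ⟨hω, hωG⟩)
        · exact Or.inl (Or.inl ⟨⟨hω, hωu⟩, hωG⟩)
    have h4 : P g f ν s ≤ P g f ν s * r + P g f ν u := by
      refine (measure_mono hsub).trans ((measure_union_le _ _).trans ?_)
      gcongr
      refine (measure_union_le _ _).trans ((add_le_add h1 h2).trans (le_of_eq ?_))
      rw [hr]
      ring
    rw [ENNReal.mul_sub fun _ _ => measure_ne_top _ _, mul_one]
    exact tsub_le_iff_left.2 h4
  refine le_trans ?_ (le_iSup₂_of_le ν hν le_rfl)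
  have hsm' : MeasurableSet s := obsFiltration.le _ _ hsm
  have hmarkov := mul_meas_ge_le_lintegral (μ := ProbabilityTheory.cond (P g f ν) s)
    (((measurable_coe_stoppingTime hτ).sub_const (ν : ℝ≥0∞))) (m : ℝ≥0∞)
  refine le_trans ?_ hmarkov
  gcongr
  rw [ProbabilityTheory.cond_apply hsm']
  have hus : u ⊆ s ∩ {ω | (m : ℝ≥0∞) ≤ (τ ω : ℝ≥0∞) - (ν : ℝ≥0∞)} := by
    intro ω (hω : ((ν + m : ℕ) : ℕ∞) ≤ τ ω)
    refine ⟨le_trans (by exact_mod_cast Nat.le_add_right ν m) hω, ?_⟩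
    have := natCast_le_coe_enat hω
    refine ENNReal.le_sub_of_add_le_left (ENNReal.natCast_ne_top ν) ?_
    exact_mod_cast this
  calc 1 - r = (P g f ν s)⁻¹ * (P g f ν s * (1 - r)) := by
        rw [← mul_assoc, ENNReal.inv_mul_cancel (by rwa [hsν]) (measure_ne_top _ _), one_mul]
    _ ≤ _ := by
        gcongr
        exact h3.trans (measure_mono hus)

/-! ### Asymptotics -/

lemma tendsto_drift_div (hfin : ∀ n, divergence (f n) g ≠ ∞) {I : ℝ} (hI : 0 < I)
    (hlim : Tendsto (fun n : ℕ => (∑ k ∈ Finset.Icc 1 n, divergence (f (k - 1)) g) / (n : ℝ≥0∞))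
      atTop (𝓝 (ENNReal.ofReal I))) :
    Tendsto (fun n : ℕ => drift g f n / n) atTop (𝓝 I) := by
  have h1 := (ENNReal.tendsto_toReal ENNReal.ofReal_ne_top).comp hlim
  rw [ENNReal.toReal_ofReal hI.le] at h1
  refine h1.congr fun n => ?_
  rw [Function.comp_apply, ENNReal.toReal_div, ENNReal.toReal_natCast,
    ENNReal.toReal_sum fun k _ => hfin _, drift]
  congr 1
  refine (Finset.sum_bij (fun j _ => j + 1) ?_ ?_ ?_ ?_).symm
  · intro j hj; rw [Finset.mem_range] at hj; rw [Finset.mem_Icc]; omega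
  · intro i _ j _ hij; omega
  · intro i hi
    rw [Finset.mem_Icc] at hi
    exact ⟨i - 1, by rw [Finset.mem_range]; omega, by omega⟩
  · intro j _; rfl

section Bounds

variable (h : ∀ n, ∫⁻ x, (logLR (f n) g x).abs ^ 4 ∂(f n).law < ∞) {C : ℝ≥0}
  (hC : ∀ n, ∫⁻ x, (logLR (f n) g x - (divergence (f n) g : EReal)).abs ^ 4 ∂(f n).law ≤ C)
  {I : ℝ} (hdrift : Tendsto (fun n : ℕ => drift g f n / n) atTop (𝓝 I))
include h hC hdrift

lemma eventually_lordenDelay_exCusum_le {J : ℝ} (hJ : 0 < J) (hJI : J < I) :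
    ∀ᶠ γ : ℝ in atTop, lordenDelay g f (exCusum g f (Real.log γ)) ≤
      ENNReal.ofReal (Real.log γ / J) := by
  -- `J < J₁ < J₁ + c < I`: the first gap absorbs the constants, the second is the deviation rate.
  obtain ⟨J₁, hJ₁, hJ₁I⟩ := exists_between hJI
  set c := (I - J₁) / 2 with hcdef
  have hc : 0 < c := by rw [hcdef]; linarith
  have hJ₁0 : 0 < J₁ := hJ.trans hJ₁
  have hev : ∀ᶠ n : ℕ in atTop, J₁ + c < drift g f n / n :=
    hdrift.eventually_const_lt (by rw [hcdef]; linarith)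
  obtain ⟨M, hM⟩ := eventually_atTop.1 hev
  have hsum : Summable fun m : ℕ => tailConst C c / (m : ℝ) ^ 2 := by
    simp_rw [div_eq_mul_inv]
    exact (Real.summable_nat_pow_inv.2 (by norm_num)).mul_left _
  have hT : 0 ≤ tailConst C c := by unfold tailConst; positivity
  set B := ∑' m : ℕ, tailConst C c / (m : ℝ) ^ 2
  have hB0 : 0 ≤ B := tsum_nonneg fun m => by positivity
  have hgap : 0 < 1 / J - 1 / J₁ := sub_pos.2 (one_div_lt_one_div_of_lt hJ hJ₁)
  have hlog : ∀ᶠ γ : ℝ in atTop, (2 + M + B) / (1 / J - 1 / J₁) ≤ Real.log γ :=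
    Real.tendsto_log_atTop.eventually_ge_atTop _
  filter_upwards [hlog, eventually_gt_atTop (1 : ℝ)] with γ hγ hγ1
  have hL : 0 < Real.log γ := Real.log_pos hγ1
  set N : ℕ := ⌈Real.log γ / J₁⌉₊ + M + 1 with hN
  have hNle : (N : ℝ) ≤ Real.log γ / J₁ + 2 + M := by
    have := (Nat.ceil_lt_add_one (by positivity : 0 ≤ Real.log γ / J₁)).le
    rw [hN]
    push_cast
    linarith
  refine (lordenDelay_exCusum_le h hC (by linarith) hc (N := N) (by omega) ?_).trans ?_
  · intro m hm
    have hm0 : (0 : ℝ) < m := by exact_mod_cast (by omega : 0 < m)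
    have h1 := hM m (by omega)
    rw [lt_div_iff₀ hm0] at h1
    have h2 : Real.log γ / J₁ ≤ m :=
      (Nat.le_ceil _).trans (by exact_mod_cast (by omega : ⌈Real.log γ / J₁⌉₊ ≤ m))
    rw [div_le_iff₀ hJ₁0] at h2
    linarith
  · rw [← ENNReal.ofReal_tsum_of_nonneg (fun m => by positivity) hsum, ← ENNReal.ofReal_natCast N,
      ← ENNReal.ofReal_add (by positivity) hB0]
    refine ENNReal.ofReal_le_ofReal ?_
    rw [div_le_iff₀ hgap] at hγ
    have : Real.log γ / J = Real.log γ / J₁ + Real.log γ * (1 / J - 1 / J₁) := by ring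
    rw [this]
    linarith

lemma eventually_le_pollakDelay (hI : 0 < I) {J : ℝ} (hIJ : I < J) :
    ∀ᶠ γ : ℝ in atTop, ∀ τ ∈ feasible g f γ,
      ENNReal.ofReal (Real.log γ / J) ≤ pollakDelay g f τ := by
  -- `I < I + c < J₂ < J₁ < J`: the window has length `log γ / J₁`, and over it the log-likelihood
  -- ratio stays below `J₂` per step.
  obtain ⟨J₁, hIJ₁, hJ₁⟩ := exists_between hIJ
  obtain ⟨J₂, hIJ₂, hJ₂⟩ := exists_between hIJ₁
  have hJ₁0 : 0 < J₁ := hI.trans hIJ₁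
  have hJ0 : 0 < J := hI.trans hIJ
  set c := (J₂ - I) / 2 with hcdef
  have hc : 0 < c := by rw [hcdef]; linarith
  set η := (1 - J₁ / J) / 2 with hη
  have hJJ : J₁ / J < 1 := (div_lt_one hJ0).2 hJ₁
  have hη0 : 0 < η := by rw [hη]; linarith
  have hη1 : J₁ / J < 1 - η := by rw [hη]; linarith
  have hη2 : 0 < 1 - η := lt_trans (by positivity) hη1
  have hT : 0 ≤ tailConst C c := by unfold tailConst; positivity
  have hac := fun n => law_eq_withDensity_likelihoodRatio (ae_coe_realLogLR_eq (h n))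
  let r : ℕ → ℝ := fun m => 2 * (m * Real.exp (-((J₁ - J₂) * m))) + tailConst C c / (m : ℝ) ^ 2
  have hr : Tendsto r atTop (𝓝 0) := by
    have h1 : Tendsto (fun x : ℝ => x * Real.exp (-((J₁ - J₂) * x))) atTop (𝓝 0) := by
      have := tendsto_rpow_mul_exp_neg_mul_atTop_nhds_zero 1 (J₁ - J₂) (by linarith)
      refine this.congr fun x => ?_
      rw [Real.rpow_one, neg_mul]
    have h2 := (h1.comp tendsto_natCast_atTop_atTop).const_mul 2
    have h3 : Tendsto (fun m : ℕ => tailConst C c / (m : ℝ) ^ 2) atTop (𝓝 0) :=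
      tendsto_const_nhds.div_atTop
        ((tendsto_pow_atTop (by norm_num)).comp tendsto_natCast_atTop_atTop)
    simpa [r] using h2.add h3
  have hev : ∀ᶠ m : ℕ in atTop, r m ≤ η ∧ drift g f m / m < J₂ - c ∧ 1 ≤ m :=
    (hr.eventually_le_const hη0).and ((hdrift.eventually_lt_const
      (by rw [hcdef]; linarith)).and (eventually_ge_atTop 1))
  have hfloor : Tendsto (fun γ : ℝ => ⌊Real.log γ / J₁⌋₊) atTop atTop :=
    tendsto_nat_floor_atTop.comp (Real.tendsto_log_atTop.atTop_div_const hJ₁0)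
  have hgap : 0 < (1 - η) / J₁ - 1 / J := by
    rw [sub_pos, lt_div_iff₀ hJ₁0]
    calc 1 / J * J₁ = J₁ / J := by ring
      _ < 1 - η := hη1
  have hlog : ∀ᶠ γ : ℝ in atTop, (1 - η) / ((1 - η) / J₁ - 1 / J) ≤ Real.log γ :=
    Real.tendsto_log_atTop.eventually_ge_atTop _
  filter_upwards [hfloor.eventually hev, hlog, eventually_gt_atTop (1 : ℝ)]
    with γ ⟨hrm, hdm, hm1⟩ hγ hγ1 τ hτ
  set m := ⌊Real.log γ / J₁⌋₊
  have hL : 0 < Real.log γ := Real.log_pos hγ1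
  have hγ0 : 0 < γ := by linarith
  have hm0 : (0 : ℝ) < m := by exact_mod_cast hm1
  have hmle : (m : ℝ) * J₁ ≤ Real.log γ := by
    rw [← le_div_iff₀ hJ₁0]
    exact Nat.floor_le (by positivity)
  have hmge : Real.log γ / J₁ - 1 ≤ m := (Nat.sub_one_lt_floor _).le
  refine le_trans ?_ (le_pollakDelay hac hτ.1 hγ0 hτ.2 hm1 (b := J₂ * m)
    (q := ENNReal.ofReal (tailConst C c / (m : ℝ) ^ 2)) fun ν hν => ?_)
  · have h1 : Real.exp (J₂ * m) * (2 * m / γ) ≤ 2 * (m * Real.exp (-((J₁ - J₂) * m))) := by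
      have h2 : Real.exp (J₂ * m) ≤ γ * Real.exp (-((J₁ - J₂) * m)) := by
        nth_rewrite 1 [← Real.exp_log hγ0]
        rw [← Real.exp_add, Real.exp_le_exp]
        linarith
      calc Real.exp (J₂ * m) * (2 * m / γ)
          ≤ (γ * Real.exp (-((J₁ - J₂) * m))) * (2 * m / γ) := by gcongr
        _ = 2 * (m * Real.exp (-((J₁ - J₂) * m))) := by field_simp
    have h3 : ENNReal.ofReal (Real.exp (J₂ * m)) * ENNReal.ofReal (2 * m / γ) +
        ENNReal.ofReal (tailConst C c / (m : ℝ) ^ 2) ≤ ENNReal.ofReal η := by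
      rw [← ENNReal.ofReal_mul (Real.exp_pos _).le, ← ENNReal.ofReal_add (by positivity)
        (by positivity)]
      exact ENNReal.ofReal_le_ofReal ((add_le_add_left h1 _).trans hrm)
    calc ENNReal.ofReal (Real.log γ / J) ≤ ENNReal.ofReal (m * (1 - η)) := by
          refine ENNReal.ofReal_le_ofReal ?_
          rw [div_le_iff₀ hgap] at hγ
          have h4 : (Real.log γ / J₁ - 1) * (1 - η) ≤ m * (1 - η) := by gcongr
          have h5 : (Real.log γ / J₁ - 1) * (1 - η) = Real.log γ / J +
            (Real.log γ * ((1 - η) / J₁ - 1 / J) - (1 - η)) := by ring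
          linarith
      _ = m * (1 - ENNReal.ofReal η) := by
          rw [ENNReal.ofReal_mul hm0.le, ENNReal.ofReal_natCast, ENNReal.ofReal_sub _ hη0.le,
            ENNReal.ofReal_one]
      _ ≤ _ := by gcongr
  · refine measure_lt_pathLR_le h hC hν hm1 hc ?_
    rw [div_lt_iff₀ hm0] at hdm
    linarith

end Bounds

/-- Two-sided bounds by `log γ / J` for `J` on either side of `I` give the asymptotics
`log γ / I`. -/
lemma tendsto_div_ofReal_log_div {F : ℝ → ℝ≥0∞} {I : ℝ} (hI : 0 < I)
    (hupper : ∀ J : ℝ, 0 < J → J < I → ∀ᶠ γ : ℝ in atTop, F γ ≤ ENNReal.ofReal (Real.log γ / J))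
    (hlower : ∀ J : ℝ, I < J → ∀ᶠ γ : ℝ in atTop, ENNReal.ofReal (Real.log γ / J) ≤ F γ) :
    Tendsto (fun γ => F γ / ENNReal.ofReal (Real.log γ / I)) atTop (𝓝 1) := by
  have hsplit : ∀ s γ : ℝ, 0 < s → ENNReal.ofReal (Real.log γ / (I / s)) =
      ENNReal.ofReal s * ENNReal.ofReal (Real.log γ / I) := by
    intro s γ hs
    rw [← ENNReal.ofReal_mul hs.le]
    congr 1
    field_simp
  have hx : ∀ᶠ γ : ℝ in atTop, ENNReal.ofReal (Real.log γ / I) ≠ 0 := by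
    filter_upwards [eventually_gt_atTop (1 : ℝ)] with γ hγ
    exact (ENNReal.ofReal_pos.2 (div_pos (Real.log_pos hγ) hI)).ne'
  refine tendsto_order.2 ⟨fun a ha => ?_, fun a ha => ?_⟩
  · obtain ⟨s, hs0, has, hs1⟩ := ENNReal.lt_iff_exists_real_btwn.1 ha
    have hs : 0 < s := ENNReal.ofReal_pos.1 (lt_of_le_of_lt zero_le has)
    rw [ENNReal.ofReal_lt_one] at hs1
    filter_upwards [hlower (I / s) (by rw [lt_div_iff₀ hs]; nlinarith), hx] with γ h1 h2
    rw [hsplit s γ hs] at h1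
    exact has.trans_le ((ENNReal.le_div_iff_mul_le (Or.inl h2)
      (Or.inl ENNReal.ofReal_ne_top)).2 h1)
  · obtain ⟨s, hs0, hs1, has⟩ := ENNReal.lt_iff_exists_real_btwn.1 ha
    rw [ENNReal.one_lt_ofReal] at hs1
    have hs : 0 < s := by linarith
    filter_upwards [hupper (I / s) (by positivity) (by rw [div_lt_iff₀ hs]; nlinarith), hx]
      with γ h1 h2
    rw [hsplit s γ hs] at h1
    exact lt_of_le_of_lt ((ENNReal.div_le_iff h2 ENNReal.ofReal_ne_top).2 h1) has

lemma tendsto_div_of_tendsto_div_ofReal_log_div {F G : ℝ → ℝ≥0∞} {I : ℝ} (hI : 0 < I)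
    (hF : Tendsto (fun γ => F γ / ENNReal.ofReal (Real.log γ / I)) atTop (𝓝 1))
    (hG : Tendsto (fun γ => G γ / ENNReal.ofReal (Real.log γ / I)) atTop (𝓝 1)) :
    Tendsto (fun γ => F γ / G γ) atTop (𝓝 1) := by
  have h1 := ENNReal.Tendsto.div hF (Or.inl one_ne_zero) hG (Or.inl ENNReal.one_ne_top)
  rw [div_one] at h1
  refine h1.congr' ?_
  filter_upwards [eventually_gt_atTop (1 : ℝ)] with γ hγ
  have hx : ENNReal.ofReal (Real.log γ / I) ≠ 0 :=
    (ENNReal.ofReal_pos.2 (div_pos (Real.log_pos hγ) hI)).ne'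
  rw [div_eq_mul_inv (F γ), div_eq_mul_inv (G γ) (ENNReal.ofReal _)]
  exact ENNReal.mul_div_mul_right _ _ (ENNReal.inv_ne_zero.2 ENNReal.ofReal_ne_top)
    (ENNReal.inv_ne_top.2 hx)

/-- A delay criterion that lies between Pollak's and Lorden's on stopping times inherits both
bounds, so that EX-CUSUM attains `log γ / I` to first order and is asymptotically optimal. -/
lemma isAsymptoticallyOptimal_exCusum_of_between
    (h : ∀ n, ∫⁻ x, (logLR (f n) g x).abs ^ 4 ∂(f n).law < ∞) {C : ℝ≥0}
    (hC : ∀ n, ∫⁻ x, (logLR (f n) g x - (divergence (f n) g : EReal)).abs ^ 4 ∂(f n).law ≤ C)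
    {I : ℝ} (hI : 0 < I)
    (hlim : Tendsto (fun n : ℕ => (∑ k ∈ Finset.Icc 1 n, divergence (f (k - 1)) g) / (n : ℝ≥0∞))
      atTop (𝓝 (ENNReal.ofReal I)))
    {delay : (Obs → ℕ∞) → ℝ≥0∞}
    (hP : ∀ τ, IsStoppingTime obsFiltration τ → pollakDelay g f τ ≤ delay τ)
    (hL : ∀ τ, IsStoppingTime obsFiltration τ → delay τ ≤ lordenDelay g f τ) :
    IsAsymptoticallyOptimal g f delay (fun γ => exCusum g f (Real.log γ)) ∧
      Tendsto (fun γ : ℝ => delay (exCusum g f (Real.log γ)) /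
        ENNReal.ofReal (Real.log γ / I)) atTop (𝓝 1) := by
  have hdrift := tendsto_drift_div (fun n => divergence_ne_top (h n)) hI hlim
  have hfeas : ∀ γ : ℝ, 0 < γ → exCusum g f (Real.log γ) ∈ feasible g f γ := fun γ hγ =>
    exCusum_mem_feasible
      (fun n => law_eq_withDensity_likelihoodRatio (ae_coe_realLogLR_eq (h n))) hγ
  have hupper : ∀ J : ℝ, 0 < J → J < I → ∀ᶠ γ : ℝ in atTop,
      delay (exCusum g f (Real.log γ)) ≤ ENNReal.ofReal (Real.log γ / J) := by
    intro J hJ hJI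
    filter_upwards [eventually_lordenDelay_exCusum_le h hC hdrift hJ hJI] with γ h1
    exact (hL _ (isStoppingTime_exCusum _)).trans h1
  have hlower : ∀ J : ℝ, I < J → ∀ᶠ γ : ℝ in atTop,
      ENNReal.ofReal (Real.log γ / J) ≤ optimalDelay g f delay γ := by
    intro J hIJ
    filter_upwards [eventually_le_pollakDelay h hC hdrift hI hIJ] with γ h1
    exact le_iInf₂ fun τ hτ => (h1 τ hτ).trans (hP τ hτ.1)
  have hopt : ∀ᶠ γ : ℝ in atTop,
      optimalDelay g f delay γ ≤ delay (exCusum g f (Real.log γ)) := by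
    filter_upwards [eventually_gt_atTop (0 : ℝ)] with γ hγ
    exact iInf₂_le _ (hfeas γ hγ)
  have hT := tendsto_div_ofReal_log_div hI hupper fun J hJ => by
    filter_upwards [hlower J hJ, hopt] with γ h1 h2 using h1.trans h2
  have hO := tendsto_div_ofReal_log_div (F := optimalDelay g f delay) hI
    (fun J hJ hJI => by
      filter_upwards [hupper J hJ hJI, hopt] with γ h1 h2 using h2.trans h1) hlower
  exact ⟨⟨hfeas, tendsto_div_of_tendsto_div_ofReal_log_div hI hT hO⟩, hT⟩

end QCD

theorem mainTheorem1 (g : QCD.ProbDensity) (f : ℕ → QCD.ProbDensity)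
    (hgf : QCD.MLR g (f 0)) (hf : ∀ n : ℕ, QCD.MLR (f n) (f (n + 1)))
    (hmoment : ∀ n : ℕ, ∫⁻ x, (QCD.logLR (f n) g x).abs ^ 4 ∂(f n).law < ∞)
    (C : ℝ≥0)
    (hcentral : ∀ n : ℕ,
      ∫⁻ x, (QCD.logLR (f n) g x - (QCD.divergence (f n) g : EReal)).abs ^ 4 ∂(f n).law ≤ C)
    (I : ℝ) (hI : 0 < I)
    (hlim : Tendsto (fun n : ℕ => (∑ k ∈ Finset.Icc 1 n, QCD.divergence (f (k - 1)) g) / (n : ℝ≥0∞))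
      atTop (𝓝 (ENNReal.ofReal I))) :
    QCD.IsAsymptoticallyOptimal g f (QCD.lordenDelay g f)
        (fun γ => QCD.exCusum g f (Real.log γ)) ∧
      QCD.IsAsymptoticallyOptimal g f (QCD.pollakDelay g f)
        (fun γ => QCD.exCusum g f (Real.log γ)) ∧
      Tendsto (fun γ : ℝ => QCD.lordenDelay g f (QCD.exCusum g f (Real.log γ)) /
        ENNReal.ofReal (Real.log γ / I)) atTop (𝓝 1) ∧
      Tendsto (fun γ : ℝ => QCD.pollakDelay g f (QCD.exCusum g f (Real.log γ)) /
        ENNReal.ofReal (Real.log γ / I)) atTop (𝓝 1) := by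
  obtain ⟨h1, h2⟩ := QCD.isAsymptoticallyOptimal_exCusum_of_between hmoment hcentral hI hlim
    (fun _ hτ => QCD.pollakDelay_le_lordenDelay hτ) (fun _ _ => le_rfl)
  obtain ⟨h3, h4⟩ := QCD.isAsymptoticallyOptimal_exCusum_of_between hmoment hcentral hI hlim
    (fun _ _ => le_rfl) (fun _ hτ => QCD.pollakDelay_le_lordenDelay hτ)
  exact ⟨h1, h3, h2, h4⟩
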